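/- Let $1\le m\le n-1$. A convex body in $\mathbf R^n$ is a closed convex set with interior points. Let $\mathcal K^{n,m}$ be the collection of unbounded convex bodies $K\subsetneq\mathbf R^n$ whose boundary $\partial K$ is homeomorphic to $\mathbf S^{n-m-1}\times\mathbf R^m$, and let $\partial\mathcal K^{n,m}=\{\partial K: K\in\mathcal K^{n,m}\}$. Let $\mathcal B^{n,m}$ be the set of all images of the cylinder $\mathbf B^{n-m}\times\mathbf R^m\subset\mathbf R^n$ under elements of $SO(n)$, where $\mathbf B^{n-m}$ is the closed unit ball of $\mathbf R^{n-m}$, and let $\partial\mathcal B^{n,m}=\{\partial B: B\in\mathcal B^{n,m}\}$. For nonempty closed convex sets $K,K'\subset\mathbf R^n$ let $\mathrm{rc}(K)=\{v: K+v\subset K\}$ be the recession cone, let $d_{bh}(A,B)$ be the Hausdorff distance between the preimages of $A,B\subset\mathbf R^n$ under the stereographic projection $\mathbf S^n\setminus\{(0,\dots,0,1)\}\to\mathbf R^n$, and let $$d_a(K,K')=d_{bh}(K,K')+d_{bh}(\mathrm{rc}(K),\mathrm{rc}(K')).$$ The asymptotic topology on $\mathcal K^{n,m}$ is the one induced by the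 metric $d_a$; the asymptotic topology on $\partial\mathcal K^{n,m}$ is the quotient topology under the boundary map $K\mapsto\partial K$. Then $\mathcal B^{n,m}\subset\mathcal K^{n,m}$, and $\mathcal K^{n,m}$ (respectively $\partial\mathcal K^{n,m}$) admits a regularity preserving strong deformation retraction onto $\mathcal B^{n,m}$ (respectively $\partial\mathcal B^{n,m}$) with respect to the asymptotic topology. That is, for $(X,A)=(\mathcal K^{n,m},\mathcal B^{n,m})$ and for $(X,A)=(\partial\mathcal K^{n,m},\partial\mathcal B^{n,m})$ there is a continuous map $X\times[0,1]\to X$, $(x,t)\mapsto x_t$, such that $x_0=x$ and $x_1\in A$ for all $x\in X$, and $x_t=x$ for all $x\in A$ and $t\in[0,1]$; moreover, for every $k$ with $1\le k\le\infty$ or $k=\omega$ (real analytic), if the hypersurface $\partial K_0$ (respectively $M_0$) carried by $x=x_0$ is an embedded hypersurface of class $C^k$ in $\mathbf R^n$, then so is the hypersurface $\partial K_t$ (respectively $M_t$) carried by $x_t$, for all $t\in[0,1]$. -/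

import Mathlib

open scoped Topology unitInterval

noncomputable section

namespace AsymptoticConvex

/-- Euclidean space `ℝⁿ`. -/
abbrev E (n : ℕ) := EuclideanSpace ℝ (Fin n)

/-! ### Stereographic projection and the bounded-Hausdorff distance -/

/-- Stereographic projection `y ↦ (y₀, …, yₙ₋₁) / (1 - yₙ)` from the north pole `(0, …, 0, 1)`
of the unit sphere `Sⁿ ⊆ ℝⁿ⁺¹` (only meaningful on the sphere minus the north pole). -/
def stereoProj {n : ℕ} (y : E (n + 1)) : E n :=
  WithLp.toLp 2 fun i => y i.castSucc / (1 - y (Fin.last n))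

/-- The inverse of stereographic projection,
`x ↦ (2 x, ‖x‖² - 1) / (‖x‖² + 1)`. -/
def stereoInv {n : ℕ} (x : E n) : E (n + 1) :=
  WithLp.toLp 2 (Fin.snoc (α := fun _ => ℝ) (fun i => 2 * x i / (‖x‖ ^ 2 + 1))
    ((‖x‖ ^ 2 - 1) / (‖x‖ ^ 2 + 1)))

@[simp] theorem stereoInv_castSucc {n : ℕ} (x : E n) (i : Fin n) :
    stereoInv x i.castSucc = 2 * x i / (‖x‖ ^ 2 + 1) := by
  simp [stereoInv]

@[simp] theorem stereoInv_last {n : ℕ} (x : E n) :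
    stereoInv x (Fin.last n) = (‖x‖ ^ 2 - 1) / (‖x‖ ^ 2 + 1) := by
  simp [stereoInv]

theorem stereoInv_last_ne {n : ℕ} (x : E n) : stereoInv x (Fin.last n) ≠ 1 := by
  have h : (‖x‖ ^ 2 + 1) ≠ 0 := by positivity
  rw [stereoInv_last, Ne, div_eq_one_iff_eq h]
  intro h'
  linarith

theorem norm_stereoInv {n : ℕ} (x : E n) : ‖stereoInv x‖ = 1 := by
  have h : (‖x‖ ^ 2 + 1) ≠ 0 := by positivity
  have h2 : ‖stereoInv x‖ ^ 2 = 1 := by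
    rw [EuclideanSpace.real_norm_sq_eq, Fin.sum_univ_castSucc]
    simp only [stereoInv_castSucc, stereoInv_last, div_pow, mul_pow]
    rw [← Finset.sum_div, ← Finset.mul_sum, ← EuclideanSpace.real_norm_sq_eq]
    field_simp
    ring
  nlinarith [norm_nonneg (stereoInv x)]

theorem stereoProj_stereoInv {n : ℕ} (x : E n) : stereoProj (stereoInv x) = x := by
  have h : (‖x‖ ^ 2 + 1) ≠ 0 := by positivity
  ext i
  simp only [stereoProj, stereoInv_castSucc, stereoInv_last]
  have h1 : 1 - (‖x‖ ^ 2 - 1) / (‖x‖ ^ 2 + 1) = 2 / (‖x‖ ^ 2 + 1) := by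
    field_simp
    ring
  rw [h1]
  field_simp

/-- The preimage in `Sⁿ` minus the north pole of `A ⊆ ℝⁿ` under stereographic projection,
see `mem_stereoLift_iff`. -/
def stereoLift {n : ℕ} (A : Set (E n)) : Set (E (n + 1)) := stereoInv '' A

theorem mem_stereoLift_iff {n : ℕ} (A : Set (E n)) (y : E (n + 1)) :
    y ∈ stereoLift A ↔ ‖y‖ = 1 ∧ y (Fin.last n) ≠ 1 ∧ stereoProj y ∈ A := by
  constructor
  · rintro ⟨x, hx, rfl⟩
    exact ⟨norm_stereoInv x, stereoInv_last_ne x, by rwa [stereoProj_stereoInv]⟩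
  · rintro ⟨hy, hy1, hA⟩
    refine ⟨stereoProj y, hA, ?_⟩
    have hs : (1 - y (Fin.last n)) ≠ 0 := fun h => hy1 (by linarith)
    have h1 : ∑ i : Fin n, y i.castSucc ^ 2 = 1 - y (Fin.last n) ^ 2 := by
      have := EuclideanSpace.real_norm_sq_eq y
      rw [Fin.sum_univ_castSucc, hy] at this
      linarith
    have h2 : ‖stereoProj y‖ ^ 2 = (1 + y (Fin.last n)) / (1 - y (Fin.last n)) := by
      rw [EuclideanSpace.real_norm_sq_eq]
      simp only [stereoProj, div_pow]
      rw [← Finset.sum_div, h1]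
      field_simp
      ring
    have h3 : ‖stereoProj y‖ ^ 2 + 1 = 2 / (1 - y (Fin.last n)) := by
      rw [h2]
      field_simp
      ring
    ext j
    refine Fin.lastCases ?_ (fun i => ?_) j
    · rw [stereoInv_last, h3, h2]
      field_simp
      ring
    · rw [stereoInv_castSucc, h3]
      simp only [stereoProj]
      field_simp

/-- The bounded-Hausdorff distance: the Hausdorff distance between the lifts to the sphere. -/
def bhDist {n : ℕ} (A B : Set (E n)) : ℝ :=
  Metric.hausdorffDist (stereoLift A) (stereoLift B)

/-- The recession cone of a set. -/
def recessionCone {n : ℕ} (K : Set (E n)) : Set (E n) := {v | ∀ x ∈ K, x + v ∈ K}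

/-- The asymptotic distance. -/
def asymDist {n : ℕ} (K L : Set (E n)) : ℝ :=
  bhDist K L + bhDist (recessionCone K) (recessionCone L)

theorem zero_mem_recessionCone {n : ℕ} (K : Set (E n)) : (0 : E n) ∈ recessionCone K :=
  fun x hx => by simpa using hx

theorem hausdorffEDist_stereoLift_ne_top {n : ℕ} {A B : Set (E n)} (hA : A.Nonempty)
    (hB : B.Nonempty) : Metric.hausdorffEDist (stereoLift A) (stereoLift B) ≠ ⊤ := by
  have hb : ∀ C : Set (E n), Bornology.IsBounded (stereoLift C) := fun C =>
    (Metric.isBounded_closedBall (x := (0 : E (n + 1))) (r := 1)).subset (by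
      rintro _ ⟨x, -, rfl⟩
      simp [norm_stereoInv])
  exact Metric.hausdorffEDist_ne_top_of_nonempty_of_bounded (hA.image _) (hB.image _) (hb A) (hb B)

theorem bhDist_nonneg {n : ℕ} (A B : Set (E n)) : 0 ≤ bhDist A B := Metric.hausdorffDist_nonneg

theorem bhDist_triangle {n : ℕ} {A B : Set (E n)} (C : Set (E n)) (hA : A.Nonempty)
    (hB : B.Nonempty) : bhDist A C ≤ bhDist A B + bhDist B C :=
  Metric.hausdorffDist_triangle (hausdorffEDist_stereoLift_ne_top hA hB)

theorem subset_of_bhDist_eq_zero {n : ℕ} {A B : Set (E n)} (hA : A.Nonempty) (hB : B.Nonempty)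
    (hBc : IsClosed B) (h : bhDist A B = 0) : A ⊆ B := by
  have hcl := (Metric.hausdorffDist_zero_iff_closure_eq_closure
    (hausdorffEDist_stereoLift_ne_top hA hB)).1 h
  intro x hx
  have hmem : stereoInv x ∈ closure (stereoLift B) := hcl ▸ subset_closure ⟨x, hx, rfl⟩
  have hcont : ContinuousAt (stereoProj (n := n)) (stereoInv x) := by
    unfold stereoProj
    refine (PiLp.continuous_toLp 2 _).continuousAt.comp (continuousAt_pi.2 fun i => ?_)
    refine ContinuousAt.div (by fun_prop) (by fun_prop) ?_
    exact fun h => stereoInv_last_ne x (by linarith)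
  have := mem_closure_image hcont hmem
  rw [stereoProj_stereoInv, stereoLift, Set.image_image] at this
  simpa [stereoProj_stereoInv, hBc.closure_eq] using this

/-! ### Closed convex sets with the asymptotic topology -/

/-- Nonempty closed convex subsets of `ℝⁿ`. -/
@[ext]
structure ClosedConvexSet (n : ℕ) where
  carrier : Set (E n)
  isClosed : IsClosed carrier
  convex : Convex ℝ carrier
  nonempty : carrier.Nonempty

/-- The asymptotic metric; its topology is the asymptotic topology. -/
instance (n : ℕ) : MetricSpace (ClosedConvexSet n) where
  dist K L := asymDist K.carrier L.carrier
  dist_self K := by simp [asymDist, bhDist]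
  dist_comm K L := by simp [asymDist, bhDist, Metric.hausdorffDist_comm]
  dist_triangle K L M := by
    have h1 := bhDist_triangle M.carrier K.nonempty L.nonempty
    have h2 := bhDist_triangle (recessionCone M.carrier)
      ⟨0, zero_mem_recessionCone K.carrier⟩ ⟨0, zero_mem_recessionCone L.carrier⟩
    simp only [asymDist]
    linarith
  eq_of_dist_eq_zero := by
    intro K L h
    have h0 : bhDist K.carrier L.carrier = 0 := by
      have h1 := bhDist_nonneg K.carrier L.carrier
      have h2 := bhDist_nonneg (recessionCone K.carrier) (recessionCone L.carrier)
      have h3 : bhDist K.carrier L.carrier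
        + bhDist (recessionCone K.carrier) (recessionCone L.carrier) = 0 := h
      linarith
    have h0' : bhDist L.carrier K.carrier = 0 := by
      rw [← h0]
      exact Metric.hausdorffDist_comm
    exact ClosedConvexSet.ext (Set.Subset.antisymm
      (subset_of_bhDist_eq_zero K.nonempty L.nonempty L.isClosed h0)
      (subset_of_bhDist_eq_zero L.nonempty K.nonempty K.isClosed h0'))

/-! ### The spaces of bodies -/

/-- `𝒦ⁿᵐ`: proper unbounded convex bodies (closed convex sets with interior points) in `ℝⁿ` whose
boundary is homeomorphic to `Sⁿ⁻ᵐ⁻¹ × ℝᵐ`. -/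
def bodies (n m : ℕ) : Set (ClosedConvexSet n) :=
  {K | (interior K.carrier).Nonempty ∧ ¬ Bornology.IsBounded K.carrier ∧ K.carrier ≠ Set.univ ∧
    Nonempty (frontier K.carrier ≃ₜ Metric.sphere (0 : E (n - m)) 1 × E m)}

/-- The cylinder `Bⁿ⁻ᵐ × ℝᵐ ⊆ ℝⁿ`: the first `n - m` coordinates form a vector of norm at
most `1`. -/
def stdCylinder (n m : ℕ) : ClosedConvexSet n where
  carrier := {x | ∑ i : Fin n with i.val < n - m, x i ^ 2 ≤ 1}
  isClosed := isClosed_le (by fun_prop) continuous_const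
  convex := by
    have h : ConvexOn ℝ Set.univ
        (fun x : E n => ∑ i : Fin n with i.val < n - m, x i ^ 2) := by
      refine ⟨convex_univ, fun x _ y _ a b ha hb hab => ?_⟩
      simp only [smul_eq_mul, Finset.mul_sum, ← Finset.sum_add_distrib]
      refine Finset.sum_le_sum fun i _ => ?_
      have := (even_two.convexOn_pow (𝕜 := ℝ)).2 (Set.mem_univ (x i)) (Set.mem_univ (y i)) ha hb hab
      simpa using this
    simpa using h.convex_le 1
  nonempty := ⟨0, by simp⟩

/-- The image of a closed convex set under a rotation. -/
def rotate {n : ℕ} (A : Matrix.specialOrthogonalGroup (Fin n) ℝ) (K : ClosedConvexSet n) :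
    ClosedConvexSet n where
  carrier := Matrix.toEuclideanLin A.1 '' K.carrier
  isClosed := by
    have hA : (A.1.transpose * A.1) = 1 :=
      (Matrix.mem_orthogonalGroup_iff' (Fin n) ℝ).1 (Matrix.mem_specialOrthogonalGroup_iff.1 A.2).1
    have hinj : Function.Injective (Matrix.toEuclideanLin A.1) := by
      refine Function.LeftInverse.injective (g := Matrix.toEuclideanLin A.1.transpose) fun x => ?_
      ext i
      simp [Matrix.toLpLin_apply, Matrix.mulVec_mulVec, hA]
    exact (LinearMap.isClosedEmbedding_of_injective
      (LinearMap.ker_eq_bot.2 hinj)).isClosedMap _ K.isClosed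
  convex := K.convex.linear_image _
  nonempty := K.nonempty.image _

/-- `ℬⁿᵐ`: the orbit of `Bⁿ⁻ᵐ × ℝᵐ` under `SO(n)`. -/
def cylinders (n m : ℕ) : Set (ClosedConvexSet n) :=
  Set.range fun A : Matrix.specialOrthogonalGroup (Fin n) ℝ => rotate A (stdCylinder n m)

/-! ### The spaces of boundary hypersurfaces -/

/-- The space `∂S` of boundaries of the members of a collection `S` of convex bodies. -/
structure Boundaries {n : ℕ} (S : Set (ClosedConvexSet n)) where
  carrier : Set (E n)
  exists_body : ∃ K ∈ S, frontier K.carrier = carrier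

/-- The boundary map `K ↦ ∂K`. -/
def boundaryMap {n : ℕ} (S : Set (ClosedConvexSet n)) (K : S) : Boundaries S :=
  ⟨frontier K.1.carrier, K.1, K.2, rfl⟩

/-- The asymptotic topology on hypersurfaces is the one transported by the (surjective) boundary
map, that is, the quotient topology. -/
instance {n : ℕ} (S : Set (ClosedConvexSet n)) : TopologicalSpace (Boundaries S) :=
  TopologicalSpace.coinduced (boundaryMap S) inferInstance

/-- `∂ℬⁿᵐ` as a subset of `∂𝒦ⁿᵐ`. -/
def cylinderBoundaries (n m : ℕ) : Set (Boundaries (bodies n m)) :=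
  {M | ∃ K ∈ cylinders n m, frontier K.carrier = M.carrier}

/-! ### Regularity and strong deformation retractions -/

/-- `M ⊆ ℝⁿ` is an embedded hypersurface of class `Cᵏ`: near each of its points it is the zero set
of a `Cᵏ` function with nonvanishing derivative. Here `k = ∞` means smooth and `k = ω` analytic. -/
def IsRegularHypersurface {n : ℕ} (k : WithTop ℕ∞) (M : Set (E n)) : Prop :=
  ∀ p ∈ M, ∃ (U : Set (E n)) (f : E n → ℝ), IsOpen U ∧ p ∈ U ∧ ContDiffOn ℝ k f U ∧
    (∀ x ∈ U, fderiv ℝ f x ≠ 0) ∧ M ∩ U = {x ∈ U | f x = 0}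

/-- `H` is a strong deformation retraction of `X` onto the subset `A`. -/
structure IsStrongDeformationRetraction {X : Type*} [TopologicalSpace X] (A : Set X)
    (H : X × I → X) : Prop where
  continuous : Continuous H
  map_zero : ∀ x, H (x, 0) = x
  map_one_mem : ∀ x, H (x, 1) ∈ A
  map_of_mem : ∀ x ∈ A, ∀ t, H (x, t) = x

/-- A homotopy `H` of a space `X` is regularity preserving, where `hyp x` is the hypersurface
carried by `x`: if `hyp x` is `Cᵏ` then so is the hypersurface carried by `H (x, t)` for all `t`,
for all `1 ≤ k ≤ ∞` and `k = ω`. -/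
def IsRegularityPreserving {X : Type*} {n : ℕ} (hyp : X → Set (E n)) (H : X × I → X) : Prop :=
  ∀ (x : X) (k : WithTop ℕ∞), 1 ≤ k → IsRegularHypersurface k (hyp x) →
    ∀ t : I, IsRegularHypersurface k (hyp (H (x, t)))

end AsymptoticConvex

end

/-!
The deformation is `K_t = (1 - t) K + rc K + t B`, where `B` is the closed unit ball (`flow`). What
makes it work is that the recession cone of every `K ∈ 𝒦ⁿᵐ` is a linear subspace `L` of dimension
`m`, so that `K = C + L` with `C ⊆ Lᗮ` compact, and `K_t = ((1 - t) C + t (B ∩ Lᗮ)) + L`. Then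
`K_0 = K`, the set `K_1` is the round cylinder over `L`, and round cylinders do not move.

*The recession cone.* Fix an interior point of `K`. Radial projection is a retraction of the
complement of `rc K` onto `∂K`. If `rc K` is not a subspace, this complement is star-shaped, so `∂K`
is contractible (`contractibleSpace_frontier`); if `rc K` is a subspace `L`, then `∂K` is
homeomorphic to the product of the unit sphere of `Lᗮ` and `L` (`nonempty_frontier_homeomorph`).
Hence it has to be shown that spheres are not contractible, and that spheres of different dimensions
are not homotopy equivalent. The identity of a sphere is not homotopic to a constant
(`not_nullhomotopic_id_sphere`) because there is no smooth retraction of the ball to the sphere; the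
latter is the analytic argument of Milnor and Rogers (`not_exists_contDiff_retraction`): the volume
of the image of the ball under `id + t (r - id)` is a polynomial in `t`, constant for small `t`, and
zero at `t = 1`. A map from a sphere to a sphere of larger dimension is homotopic to a constant
(`nullhomotopic_of_finrank_lt`), since a `C¹` approximation is not surjective.

*Continuity.* The chordal distance between the preimages of `x` and `y` on the sphere is
`2 ‖x - y‖ / √((1 + ‖x‖²) (1 + ‖y‖²))`. So it suffices to match the points of `K_t` and `K'_{t'}`
up to an error of `η (1 + ‖x‖)`. Closeness of `K` to `K'` controls the compact cross-sections, and
closeness of the recession cones `L` and `L'` controls the linear parts (`exists_mem_flow_close`).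
Both directions are needed, and for the second one a bound for the cross-section of `K'` in terms
of that of `K` (`norm_starProjection_le_of_close`).

*Regularity.* For `t > 0`, `K_t` is the closed `t`-neighbourhood of the closed convex set
`A = (1 - t) K + rc K`, a homothetic copy of `K` if `t < 1` and the subspace `L` if `t = 1`. If `∂A`
is of class `Cʲ⁺¹`, then the nearest-point projection `P` of `A` is of class `Cʲ` outside `A`, by
the inverse function theorem applied to the normal map (`IsNearestPoint.contDiffAt`). The squared
distance to `A` has gradient `2 (x - P x)`, hence is of class `Cʲ⁺¹` outside `A`
(`IsNearestPoint.contDiffOn_norm_sq`), and `∂K_t` is one of its regular level sets.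

*Boundaries.* As `m < n`, a body in `𝒦ⁿᵐ` is the convex hull of its boundary
(`convexHull_frontier_eq`). So the boundary map is a bijection, and a homeomorphism for the quotient
topology (`boundaryHomeomorph`), along which the deformation is transported.
-/

noncomputable section

namespace AsymptoticConvex

section NoRetraction

open MeasureTheory Metric Set Polynomial

variable {V : Type*} [NormedAddCommGroup V] [InnerProductSpace ℝ V] [FiniteDimensional ℝ V]

/-! ### There is no smooth retraction of the ball to the sphere -/

/-- The value at `1` of a polynomial of bounded degree is a fixed affine combination of its values
at prescribed nodes in `(0, T]`; this is applied to `t ↦ det (1 + t M)`. -/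
theorem exists_weights_det_one_add (V : Type*) [NormedAddCommGroup V] [InnerProductSpace ℝ V]
    [FiniteDimensional ℝ V] {T : ℝ} (hT : 0 < T) :
    ∃ (s : Finset ℕ) (v c : ℕ → ℝ), (∀ i ∈ s, 0 < v i ∧ v i ≤ T) ∧ ∑ i ∈ s, c i = 1 ∧
      ∀ M : V →L[ℝ] V, (1 + M).det = ∑ i ∈ s, c i * (1 + v i • M).det := by
  set d := Module.finrank ℝ V
  set s := Finset.range (d + 1)
  set v : ℕ → ℝ := fun i => T / (i + 1)
  have hv : Set.InjOn v s := by
    intro i _ j _ hij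
    have h1 : (i : ℝ) + 1 ≠ 0 := by positivity
    have h2 : (j : ℝ) + 1 ≠ 0 := by positivity
    simp only [v] at hij
    field_simp at hij
    exact_mod_cast (add_right_cancel hij).symm
  have key : ∀ p : ℝ[X], p.natDegree ≤ d →
      p.eval 1 = ∑ i ∈ s, (Lagrange.basis s v i).eval 1 * p.eval (v i) := by
    intro p hp
    have hdeg : p.degree < s.card := by
      refine lt_of_le_of_lt degree_le_natDegree ?_
      simp only [s, Finset.card_range]
      exact_mod_cast Nat.lt_succ_of_le hp
    conv_lhs => rw [Lagrange.eq_interpolate hv hdeg, Lagrange.interpolate_apply]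
    rw [eval_finsetSum]
    refine Finset.sum_congr rfl fun i _ => ?_
    simp [mul_comm]
  refine ⟨s, v, fun i => (Lagrange.basis s v i).eval 1, fun i _ => ⟨by positivity, ?_⟩, ?_, ?_⟩
  · exact div_le_self hT.le (by linarith [(Nat.cast_nonneg i : (0 : ℝ) ≤ i)])
  · simpa using (key 1 (by simp)).symm
  · intro M
    let b := Module.finBasis ℝ V
    let A := LinearMap.toMatrix b b (M : V →ₗ[ℝ] V)
    let p : ℝ[X] := ((X : ℝ[X]) • A.map C + (1 : Matrix (Fin d) (Fin d) ℝ).map C).det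
    have hp : ∀ t : ℝ, p.eval t = (1 + t • M).det := by
      intro t
      have h1 : (1 + t • M).det = (LinearMap.toMatrix b b
          ((1 + t • M : V →L[ℝ] V) : V →ₗ[ℝ] V)).det := by
        rw [LinearMap.det_toMatrix]
      have h2 : LinearMap.toMatrix b b ((1 + t • M : V →L[ℝ] V) : V →ₗ[ℝ] V) = 1 + t • A := by
        rw [show ((1 + t • M : V →L[ℝ] V) : V →ₗ[ℝ] V) = 1 + t • (M : V →ₗ[ℝ] V) from rfl, map_add,
          map_smul, LinearMap.toMatrix_one]
      rw [h1, h2, ← Polynomial.coe_evalRingHom, RingHom.map_det]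
      congr 1
      ext i j
      by_cases hij : i = j <;> simp [hij, add_comm, mul_comm t]
    have := key p ((natDegree_det_X_add_C_le A 1).trans (by simp [d]))
    simpa [hp] using this

/-- If `t ‖M‖ < 1`, then `det (1 + t M)` is positive: `det (1 + s M)` equals `1` at `s = 0`, and it
does not vanish on `[0, t]`, where `1 + s M` is injective. -/
theorem det_one_add_smul_pos {M : V →L[ℝ] V} {t c : ℝ} (ht : 0 ≤ t)
    (hM : ∀ v, ‖M v‖ ≤ c * ‖v‖) (htc : t * c < 1) : 0 < (1 + t • M).det := by
  have hne : ∀ s ∈ Icc 0 t, (1 + s • M).det ≠ 0 := by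
    intro s hs h0
    obtain ⟨v, hv, hv0⟩ := LinearMap.bot_lt_ker_of_det_eq_zero
      (f := ((1 + s • M : V →L[ℝ] V) : V →ₗ[ℝ] V)) h0 |> (Submodule.ne_bot_iff _).1 ∘ ne_of_gt
    have hv' : v + s • M v = 0 := by simpa using hv
    have h1 : ‖v‖ = s * ‖M v‖ := by
      conv_lhs => rw [eq_neg_of_add_eq_zero_left hv', norm_neg, norm_smul, Real.norm_of_nonneg hs.1]
    have h2 : 0 < ‖v‖ := norm_pos_iff.2 hv0
    have h3 : s * ‖M v‖ ≤ t * (c * ‖v‖) := mul_le_mul hs.2 (hM v) (norm_nonneg _) ht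
    nlinarith
  have hcont : ContinuousOn (fun s : ℝ => (1 + s • M).det) (Icc 0 t) :=
    (ContinuousLinearMap.continuous_det.comp (by fun_prop)).continuousOn
  by_contra! hle
  obtain ⟨s, hs, hs0⟩ := intermediate_value_Icc' ht hcont
    (show (0 : ℝ) ∈ Icc ((1 + t • M).det) ((1 + (0 : ℝ) • M).det) from ⟨hle, by
      simp [ContinuousLinearMap.det]⟩)
  exact hne s hs hs0

/-- A map which vanishes on the unit sphere and is Lipschitz on the closed unit ball stays
Lipschitz when it is extended by zero. -/
theorem lipschitz_extend_zero {V : Type*} [NormedAddCommGroup V] [InnerProductSpace ℝ V]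
    {φ : V → V} {c : NNReal} (hφ : LipschitzOnWith c φ (closedBall 0 1))
    (h0 : ∀ x, ‖x‖ = 1 → φ x = 0) :
    LipschitzWith c (fun x => open Classical in if ‖x‖ ≤ 1 then φ x else 0) := by
  classical
  have key : ∀ x y : V, ‖x‖ ≤ 1 → 1 < ‖y‖ → ‖φ x‖ ≤ c * ‖x - y‖ := by
    intro x y hx hy
    obtain ⟨s, hs, hsz⟩ := intermediate_value_Icc (zero_le_one' ℝ)
      (f := fun s : ℝ => ‖x + s • (y - x)‖) (by fun_prop)
      (show (1 : ℝ) ∈ _ from ⟨by simpa using hx, by simpa using hy.le⟩)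
    have hd := hφ.dist_le_mul x (by simpa using hx) (x + s • (y - x)) (by simpa using hsz.le)
    rw [h0 _ hsz, dist_zero_right, dist_eq_norm] at hd
    refine hd.trans (mul_le_mul_of_nonneg_left ?_ c.2)
    have : x - (x + s • (y - x)) = s • (x - y) := by rw [smul_sub, smul_sub]; abel
    rw [this, norm_smul, Real.norm_of_nonneg hs.1]
    exact mul_le_of_le_one_left (norm_nonneg _) hs.2
  refine LipschitzWith.of_dist_le_mul fun x y => ?_
  simp only [dist_eq_norm]
  by_cases hx : ‖x‖ ≤ 1 <;> by_cases hy : ‖y‖ ≤ 1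
  · simpa [hx, hy, dist_eq_norm] using hφ.dist_le_mul x (by simpa using hx) y (by simpa using hy)
  · simpa [hx, hy] using key x y hx (not_le.1 hy)
  · simpa [hx, hy, norm_sub_rev] using key y x hy (not_le.1 hx)
  · simp [hx, hy]; positivity

/-- There is no `C¹` map to the unit sphere that fixes the unit sphere. Along
`f_t = id + t (r - id)` the volume of the image of the ball is a polynomial in `t`; it is constant
for small `t`, where `f_t` is a bijection of the ball, but vanishes at `t = 1`. -/
theorem not_exists_contDiff_retraction [Nontrivial V] (r : V → V) (hr : ContDiff ℝ 1 r)
    (h1 : ∀ x, ‖r x‖ = 1) (hid : ∀ x, ‖x‖ = 1 → r x = x) : False := by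
  classical
  let _ : MeasurableSpace V := borel V
  have : BorelSpace V := ⟨rfl⟩
  set φ : V → V := fun x => r x - x with hφdef
  have hφ : ContDiff ℝ 1 φ := hr.sub contDiff_id
  obtain ⟨c, hc⟩ : ∃ c : NNReal, ∀ x ∈ closedBall (0 : V) 1, ‖fderiv ℝ φ x‖₊ ≤ c := by
    obtain ⟨C, hC⟩ := (isCompact_closedBall (0 : V) 1).exists_bound_of_continuousOn
      (hφ.continuous_fderiv (by simp)).continuousOn
    exact ⟨C.toNNReal, fun x hx => NNReal.coe_le_coe.1 ((hC x hx).trans (Real.le_coe_toNNReal C))⟩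
  have hlip : LipschitzOnWith c φ (closedBall 0 1) :=
    (convex_closedBall (0 : V) 1).lipschitzOnWith_of_nnnorm_fderiv_le
      (fun x _ => (hφ.differentiable (by simp)) x) hc
  set ψ : V → V := fun x => if ‖x‖ ≤ 1 then φ x else 0 with hψdef
  have hψ : LipschitzWith c ψ := lipschitz_extend_zero hlip fun x hx => by simp [φ, hid x hx]
  set T : ℝ := 1 / (c + 1) with hTdef
  have hT : 0 < T := by positivity
  have hTc : T * c < 1 := by
    rw [hTdef, one_div, ← div_eq_inv_mul, div_lt_one (by positivity)]
    linarith
  set B : Set V := ball 0 1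
  have hB : MeasurableSet B := measurableSet_ball
  set q : V → ℝ → ℝ := fun x t => (1 + t • fderiv ℝ φ x).det with hq
  have hqc : ∀ t, Continuous fun x => q x t := fun t =>
    ContinuousLinearMap.continuous_det.comp (by
      have := hφ.continuous_fderiv (by simp)
      fun_prop)
  have hint : ∀ t, IntegrableOn (fun x => q x t) B Measure.addHaar := fun t =>
    (((hqc t).continuousOn).integrableOn_compact (isCompact_closedBall (0 : V) 1)).mono_set
      ball_subset_closedBall
  -- For small `t` the map `x ↦ x + t ψ x` is a bijection of `V` that is the identity outside `B`.
  have hvol : ∀ t, 0 < t → t ≤ T → ∫ x in B, q x t ∂Measure.addHaar = Measure.addHaar.real B := by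
    intro t ht htT
    have htc : t * c < 1 := lt_of_le_of_lt (mul_le_mul_of_nonneg_right htT c.2) hTc
    set F : V → V := fun x => x + t • ψ x with hF
    have hinj : Function.Injective F := by
      intro x y hxy
      have h : x - y = t • (ψ y - ψ x) := by
        simp only [hF] at hxy
        rw [smul_sub, sub_eq_sub_iff_add_eq_add, add_comm (t • ψ y)]
        exact hxy
      have h2 : ‖x - y‖ ≤ t * (c * ‖x - y‖) := by
        conv_lhs => rw [h, norm_smul, Real.norm_of_nonneg ht.le]
        have := hψ.dist_le_mul y x
        rw [dist_eq_norm, dist_eq_norm, norm_sub_rev y x] at this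
        exact mul_le_mul_of_nonneg_left this ht.le
      rcases (norm_nonneg (x - y)).eq_or_lt with h0 | h0
      · exact sub_eq_zero.1 (norm_eq_zero.1 h0.symm)
      · nlinarith
    have hsurj : Function.Surjective F := by
      intro y
      have hcon : ContractingWith (t.toNNReal * c) (fun x => y - t • ψ x) := by
        refine ⟨?_, LipschitzWith.of_dist_le_mul fun a b => ?_⟩
        · rw [← NNReal.coe_lt_coe]
          simpa [ht.le] using htc
        · have : dist (y - t • ψ a) (y - t • ψ b) = t * dist (ψ a) (ψ b) := by
            rw [dist_sub_left, dist_smul₀, Real.norm_of_nonneg ht.le]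
          rw [this, NNReal.coe_mul, Real.coe_toNNReal t ht.le, mul_assoc]
          exact mul_le_mul_of_nonneg_left (hψ.dist_le_mul a b) ht.le
      refine ⟨hcon.fixedPoint _, ?_⟩
      have : y - t • ψ (hcon.fixedPoint _) = hcon.fixedPoint _ := hcon.fixedPoint_isFixedPt
      exact (sub_eq_iff_eq_add.1 this).symm
    have hout : ∀ x, x ∉ B → F x = x := by
      intro x hx
      have hx1 : 1 ≤ ‖x‖ := by simpa [B] using hx
      have : ψ x = 0 := by
        simp only [hψdef]
        split_ifs with h
        · simp [φ, hid x (le_antisymm h hx1)]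
        · rfl
      simp [hF, this]
    have himg : F '' B = B := by
      have h2 : F '' Bᶜ = Bᶜ := by
        ext y
        constructor
        · rintro ⟨x, hx, rfl⟩; rwa [hout x hx]
        · exact fun hy => ⟨y, hy, hout y hy⟩
      have h3 := image_compl_eq (s := B) ⟨hinj, hsurj⟩
      rw [h2] at h3
      exact (compl_injective h3).symm
    have hder : ∀ x ∈ B, HasFDerivWithinAt F (1 + t • fderiv ℝ φ x) B x := by
      intro x hx
      have h : HasFDerivAt (fun x => x + t • φ x) (1 + t • fderiv ℝ φ x) x :=
        (hasFDerivAt_id x).add (((hφ.differentiable (by simp)) x).hasFDerivAt.const_smul t)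
      refine h.hasFDerivWithinAt.congr (fun y hy => ?_) ?_
      · have : ‖y‖ ≤ 1 := by simpa using (mem_ball_zero_iff.1 hy).le
        simp [hF, hψdef, this]
      · have : ‖x‖ ≤ 1 := by simpa using (mem_ball_zero_iff.1 hx).le
        simp [hF, hψdef, this]
    have hpos : ∀ x ∈ B, 0 < q x t := fun x hx =>
      det_one_add_smul_pos ht.le (fun v => (ContinuousLinearMap.le_opNorm _ v).trans
        (mul_le_mul_of_nonneg_right (hc x (ball_subset_closedBall hx)) (norm_nonneg v))) htc
    have hch := lintegral_abs_det_fderiv_eq_addHaar_image Measure.addHaar hB hder hinj.injOn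
    rw [himg] at hch
    rw [integral_eq_lintegral_of_nonneg_ae
      ((ae_restrict_mem hB).mono fun x hx => (hpos x hx).le) (hqc t).aestronglyMeasurable,
      measureReal_def, ← hch]
    congr 1
    refine setLIntegral_congr_fun hB fun x hx => ?_
    rw [← abs_of_pos (hpos x hx)]
  obtain ⟨s, v, w, hv, hw, hdet⟩ := exists_weights_det_one_add V hT
  have hone : ∫ x in B, q x 1 ∂Measure.addHaar = Measure.addHaar.real B := by
    have h : ∀ x, q x 1 = ∑ i ∈ s, w i * q x (v i) := fun x => by
      simpa [hq] using hdet (fderiv ℝ φ x)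
    simp_rw [h]
    rw [integral_finsetSum _ fun i _ => (hint (v i)).const_mul (w i)]
    simp_rw [integral_const_mul]
    rw [Finset.sum_congr rfl fun i hi => by rw [hvol (v i) (hv i hi).1 (hv i hi).2],
      ← Finset.sum_mul, hw, one_mul]
  -- `r x` is a unit vector for all `x`, so `Dr x` takes values in the orthogonal
  -- complement of `r x`, hence is singular.
  have hzero : ∀ x, q x 1 = 0 := by
    intro x
    have hrx : HasFDerivAt r (fderiv ℝ r x) x := ((hr.differentiable (by simp)) x).hasFDerivAt
    have h1' : 1 + (1 : ℝ) • fderiv ℝ φ x = fderiv ℝ r x := by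
      have : fderiv ℝ φ x = fderiv ℝ r x - 1 :=
        (hrx.sub (hasFDerivAt_id x)).fderiv
      rw [this, one_smul]; abel
    have horth : ∀ u, inner ℝ (r x) (fderiv ℝ r x u) = 0 := by
      intro u
      have h := (hrx.inner ℝ hrx)
      have hconst : (fun y => inner ℝ (r y) (r y)) = fun _ => (1 : ℝ) := by
        funext y; rw [real_inner_self_eq_norm_sq, h1, one_pow]
      rw [hconst] at h
      have h2 := congrArg (fun L => L u) (h.unique (hasFDerivAt_const (1 : ℝ) x))
      simp [fderivInnerCLM_apply, real_inner_comm (r x)] at h2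
      linarith [real_inner_comm (r x) (fderiv ℝ r x u)]
    simp only [hq, h1']
    by_contra hne
    have hunit : IsUnit (LinearMap.det (fderiv ℝ r x : V →ₗ[ℝ] V)) := isUnit_iff_ne_zero.2 hne
    obtain ⟨u, hu⟩ := ((LinearMap.isUnit_iff_range_eq_top _).1
      ((LinearMap.isUnit_iff_isUnit_det _).2 hunit)).symm ▸ Submodule.mem_top (x := r x)
    have h3 := horth u
    rw [show fderiv ℝ r x u = r x from hu, real_inner_self_eq_norm_sq, h1] at h3
    norm_num at h3
  simp only [hzero, integral_zero] at hone
  have : 0 < Measure.addHaar.real B := by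
    rw [measureReal_def]
    exact ENNReal.toReal_pos (measure_ball_pos _ _ one_pos).ne' measure_ball_lt_top.ne
  linarith

end NoRetraction

section Spheres

open Metric Set ContinuousMap

variable {V W X : Type*} [NormedAddCommGroup V] [InnerProductSpace ℝ V]
  [NormedAddCommGroup W] [InnerProductSpace ℝ W] [TopologicalSpace X]

/-! ### Maps between spheres -/

/-- The unit vector in the direction of a nonzero vector, as a point of the unit sphere. -/
def toSphere : C({x : V // x ≠ 0}, sphere (0 : V) 1) where
  toFun x := ⟨‖x.1‖⁻¹ • x.1, by
    rw [mem_sphere_zero_iff_norm, norm_smul, norm_inv, norm_norm,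
      inv_mul_cancel₀ (norm_ne_zero_iff.2 x.2)]⟩
  continuous_toFun := by
    refine Continuous.subtype_mk ?_ _
    exact (continuous_subtype_val.norm.inv₀ fun x => norm_ne_zero_iff.2 x.2).smul
      continuous_subtype_val

@[simp] theorem toSphere_coe (x : {x : V // x ≠ 0}) : (toSphere x : V) = ‖x.1‖⁻¹ • x.1 := rfl

/-- Two maps to a sphere which are nowhere antipodal are homotopic. -/
theorem homotopic_of_ne_neg (f g : C(X, sphere (0 : W) 1)) (h : ∀ x, (f x : W) ≠ -(g x : W)) :
    f.Homotopic g := by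
  have hne : ∀ p : I × X, (1 - (p.1 : ℝ)) • (f p.2 : W) + (p.1 : ℝ) • (g p.2 : W) ≠ 0 := by
    rintro ⟨t, x⟩ h0
    have h1 := eq_neg_of_add_eq_zero_left h0
    have h2 := congrArg norm h1
    simp only [norm_neg, norm_smul, norm_eq_of_mem_sphere, mul_one, Real.norm_eq_abs,
      abs_of_nonneg t.2.1, abs_of_nonneg (sub_nonneg.2 t.2.2)] at h2
    have ht : (t : ℝ) = 1 / 2 := by linarith
    simp only [ht] at h1
    apply h x
    have h3 : (1 / 2 : ℝ) • (f x : W) = (1 / 2 : ℝ) • (-(g x : W)) := by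
      rw [smul_neg, ← h1]; norm_num
    exact smul_right_injective W (by norm_num : (1 / 2 : ℝ) ≠ 0) h3
  refine ⟨⟨⟨fun p => toSphere ⟨_, hne p⟩, ?_⟩, fun x => ?_, fun x => ?_⟩⟩
  · refine toSphere.continuous.comp (Continuous.subtype_mk ?_ _)
    fun_prop
  · ext; simp
  · ext; simp

/-- The identity of the unit sphere is not homotopic to a constant: a homotopy would give a
retraction of the ball, which can be made smooth. -/
theorem not_nullhomotopic_id_sphere [FiniteDimensional ℝ V] :
    ¬ (ContinuousMap.id (sphere (0 : V) 1)).Nullhomotopic := by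
  classical
  rintro ⟨p, ⟨H⟩⟩
  have hnt : Nontrivial V := ⟨p, 0, fun h => by simpa [h] using norm_eq_of_mem_sphere p⟩
  -- The homotopy, read along the radii `1/2 ≤ ‖x‖ ≤ 1`, extends `x ↦ x / ‖x‖` from the complement
  -- of the unit ball to a map `R` of the whole space to the sphere.
  set u : V → sphere (0 : V) 1 := fun x => if h : x = 0 then p else toSphere ⟨x, h⟩ with hu
  set τ : V → I := fun x => projIcc 0 1 zero_le_one (2 - 2 * ‖x‖) with hτ
  have hτc : Continuous τ := continuous_projIcc.comp (by fun_prop)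
  set R : V → V := fun x => (H (τ x, u x) : V) with hR
  have hτ0 : ∀ x : V, 1 ≤ ‖x‖ → τ x = 0 := fun x hx =>
    projIcc_of_le_left _ (by linarith)
  have hτ1 : ∀ x : V, ‖x‖ ≤ 1 / 2 → τ x = 1 := fun x hx =>
    projIcc_of_right_le _ (by linarith)
  have hRcont : Continuous R := by
    rw [continuous_iff_continuousAt]
    intro x₀
    by_cases hx₀ : x₀ = 0
    · have : R =ᶠ[𝓝 x₀] fun _ => (p : V) := by
        filter_upwards [ball_mem_nhds x₀ (by norm_num : (0 : ℝ) < 1 / 2)] with x hx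
        have : ‖x‖ ≤ 1 / 2 := by simpa [hx₀] using (mem_ball.1 hx).le
        simp [hR, hτ1 x this]
      exact continuousAt_const.congr this.symm
    · have huc : ContinuousAt u x₀ := by
        rw [Topology.IsInducing.subtypeVal.continuousAt_iff]
        have : (Subtype.val ∘ u) =ᶠ[𝓝 x₀] fun x => ‖x‖⁻¹ • x := by
          filter_upwards [isOpen_ne.mem_nhds hx₀] with x hx
          have hx' : x ≠ 0 := hx
          simp [hu, hx']
        refine ContinuousAt.congr ?_ this.symm
        exact (continuousAt_id.norm.inv₀ (norm_ne_zero_iff.2 hx₀)).smul continuousAt_id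
      exact (continuous_subtype_val.comp H.continuous).continuousAt.comp
        (hτc.continuousAt.prodMk huc)
  have hRnorm : ∀ x, ‖R x‖ = 1 := fun x => norm_eq_of_mem_sphere _
  have hRout : ∀ x : V, 1 ≤ ‖x‖ → R x = ‖x‖⁻¹ • x := by
    intro x hx
    have hx0 : x ≠ 0 := fun h => by simp [h] at hx; linarith
    simp [hR, hτ0 x hx, hu, hx0]
  -- A `C¹` approximation `G` which agrees with `R` outside the ball of radius `2`; rescaled and
  -- normalized it is a retraction.
  have hopen : IsOpen {x : V | 1 < ‖x‖} := isOpen_lt continuous_const continuous_norm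
  obtain ⟨G, hG, hGR, hGeq, -⟩ := hRcont.exists_contDiff_approx_and_eqOn (ε := fun _ => 1 / 2) 1
    continuous_const (fun _ => by norm_num) (S := {x | 2 ≤ ‖x‖}) (U := {x | 1 < ‖x‖})
    (isClosed_le continuous_const continuous_norm)
    (hopen.mem_nhdsSet.2 fun x (hx : 2 ≤ ‖x‖) => show 1 < ‖x‖ by linarith)
    (by
      refine ContDiffOn.congr (f := fun x => ‖x‖⁻¹ • x) ?_ fun x hx => hRout x hx.le
      intro x hx
      have hx0 : x ≠ 0 := fun h => by simp [h] at hx; linarith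
      exact (((contDiffAt_norm ℝ hx0).inv (norm_ne_zero_iff.2 hx0)).smul
        contDiffAt_id).contDiffWithinAt)
  have hG0 : ∀ x, G x ≠ 0 := by
    intro x h0
    have := hGR x
    rw [h0, dist_zero_left, hRnorm] at this
    norm_num at this
  refine not_exists_contDiff_retraction (fun x => ‖G ((2 : ℝ) • x)‖⁻¹ • G ((2 : ℝ) • x)) ?_ ?_ ?_
  · have hG2 : ContDiff ℝ 1 fun x : V => G ((2 : ℝ) • x) := hG.comp (contDiff_const_smul _)
    exact ((hG2.norm ℝ fun x => hG0 _).inv fun x => norm_ne_zero_iff.2 (hG0 _)).smul hG2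
  · intro x
    rw [norm_smul, norm_inv, norm_norm, inv_mul_cancel₀ (norm_ne_zero_iff.2 (hG0 _))]
  · intro x hx
    have h2 : ‖(2 : ℝ) • x‖ = 2 := by rw [norm_smul, hx]; norm_num
    have : G ((2 : ℝ) • x) = x := by
      rw [hGeq h2.ge, hRout _ (by rw [h2]; norm_num), h2, smul_smul]; norm_num
    rw [this, hx, inv_one, one_smul]

/-- A map from a sphere to a sphere of larger dimension is homotopic to a constant: a smooth
approximation misses a direction, for dimension reasons. -/
theorem nullhomotopic_of_finrank_lt [FiniteDimensional ℝ V] [FiniteDimensional ℝ W]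
    (h : Module.finrank ℝ V < Module.finrank ℝ W) (f : C(sphere (0 : V) 1, sphere (0 : W) 1)) :
    f.Nullhomotopic := by
  classical
  have hnt : Nontrivial W := Module.nontrivial_of_finrank_pos (R := ℝ) (by omega)
  -- `F` is the extension of `f` that is homogeneous of degree one.
  set F : V → W := fun x => if h : x = 0 then 0 else ‖x‖ • (f (toSphere ⟨x, h⟩) : W) with hF
  have hFn : ∀ x, ‖F x‖ = ‖x‖ := by
    intro x
    by_cases hx : x = 0
    · simp [hF, hx]
    · simp only [hF, hx, dite_false, norm_smul, norm_norm, norm_eq_of_mem_sphere, mul_one]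
  have hFS : ∀ x : sphere (0 : V) 1, F x = f x := by
    intro x
    have hx : (x : V) ≠ 0 := fun h => by simpa [h] using norm_eq_of_mem_sphere x
    have : toSphere ⟨(x : V), hx⟩ = x := by ext; simp
    simp [hF, hx, this]
  have hFc : Continuous F := by
    rw [continuous_iff_continuousAt]
    intro x₀
    by_cases hx₀ : x₀ = 0
    · have h0 : F x₀ = 0 := by simp [hF, hx₀]
      rw [ContinuousAt, h0, tendsto_zero_iff_norm_tendsto_zero]
      simp_rw [hFn]
      simpa [hx₀] using (continuous_norm (E := V)).tendsto x₀
    · have hc : ContinuousOn F {x | x ≠ 0} := by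
        rw [continuousOn_iff_continuous_domRestrict]
        have : ({x : V | x ≠ 0}).domRestrict F = fun x : {x : V // x ≠ 0} =>
            ‖(x : V)‖ • (f (toSphere x) : W) := by
          funext x
          simp [hF]
          intro hx; exact absurd hx x.2
        rw [this]
        fun_prop
      exact hc.continuousAt (isOpen_ne.mem_nhds hx₀)
  obtain ⟨G, hG, hGF, -⟩ := hFc.exists_contDiff_approx (ε := fun _ => 1 / 2) 1 continuous_const
    (fun _ => by norm_num)
  have hG0 : ∀ x : sphere (0 : V) 1, G x ≠ 0 := by
    intro x h0
    have := hGF x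
    rw [h0, dist_zero_left, hFn, norm_eq_of_mem_sphere] at this
    norm_num at this
  set g : C(sphere (0 : V) 1, sphere (0 : W) 1) :=
    toSphere.comp ⟨fun x => ⟨G x, hG0 x⟩, Continuous.subtype_mk
      (hG.continuous.comp continuous_subtype_val) _⟩ with hg
  have hfg : f.Homotopic g := by
    refine homotopic_of_ne_neg f g fun x hx => ?_
    have h1 : ‖G x‖ • (f x : W) = -G x := by
      rw [hx]
      simp [hg, smul_smul, mul_inv_cancel₀ (norm_ne_zero_iff.2 (hG0 x))]
    have h2 := hGF x
    rw [hFS, dist_eq_norm, ← norm_neg, neg_sub, sub_eq_add_neg, ← h1,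
      show (f x : W) + ‖G x‖ • (f x : W) = (1 + ‖G x‖) • (f x : W) by rw [add_smul, one_smul],
      norm_smul, norm_eq_of_mem_sphere, mul_one, Real.norm_of_nonneg (by positivity)] at h2
    linarith [norm_nonneg (G x)]
  -- The cone over the image of `G` has dimension at most that of `V`.
  set Z : Set W := (fun x : V => ‖x‖ • G (‖x‖⁻¹ • x)) '' {0}ᶜ with hZ
  have hdim : dimH Z ≤ Module.finrank ℝ V := by
    refine (dimH_image_le_of_locally_lipschitzOn fun x hx => ?_).trans
      ((dimH_mono (subset_univ _)).trans (Real.dimH_univ_eq_finrank V).le)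
    have hx0 : x ≠ 0 := hx
    have hd : ContDiffAt ℝ 1 (fun x : V => ‖x‖ • G (‖x‖⁻¹ • x)) x := by
      have hn := contDiffAt_norm (n := 1) ℝ hx0
      exact hn.smul (hG.contDiffAt.comp x
        ((hn.inv (norm_ne_zero_iff.2 hx0)).smul contDiffAt_id))
    obtain ⟨K, t, ht, hK⟩ := hd.exists_lipschitzOnWith
    exact ⟨K, t, mem_nhdsWithin_of_mem_nhds ht, hK⟩
  have hdense : Dense Zᶜ := dense_compl_of_dimH_lt_finrank
    (hdim.trans_lt (by exact_mod_cast h))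
  obtain ⟨v, hv0, hvZ⟩ := hdense.inter_open_nonempty {0}ᶜ isOpen_compl_singleton
    (exists_ne (0 : W))
  have hv0' : -v ≠ 0 := neg_ne_zero.2 hv0
  -- The map `g` avoids the direction of `v`, so it is homotopic to the constant `-v / ‖v‖`.
  refine ⟨toSphere ⟨-v, hv0'⟩, hfg.trans (homotopic_of_ne_neg _ _ fun x hx => hvZ ?_)⟩
  have hx' : ‖G x‖⁻¹ • G x = ‖v‖⁻¹ • v := by simpa [hg] using hx
  have hvn : ‖v‖ ≠ 0 := norm_ne_zero_iff.2 hv0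
  have hGn : ‖G x‖ ≠ 0 := norm_ne_zero_iff.2 (hG0 x)
  have hs : 0 < ‖v‖ / ‖G x‖ := by positivity
  refine ⟨(‖v‖ / ‖G x‖) • (x : V), ?_, ?_⟩
  · rw [mem_compl_singleton_iff, Ne, smul_eq_zero, not_or]
    exact ⟨hs.ne', fun h => by simpa [h] using norm_eq_of_mem_sphere x⟩
  · have hn : ‖(‖v‖ / ‖G x‖) • (x : V)‖ = ‖v‖ / ‖G x‖ := by
      rw [norm_smul, norm_eq_of_mem_sphere, mul_one, Real.norm_of_nonneg hs.le]
    simp only [hn]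
    rw [smul_smul, inv_mul_cancel₀ hs.ne', one_smul, div_eq_mul_inv, mul_smul, hx', smul_smul,
      mul_inv_cancel₀ hvn, one_smul]

/-- The projection `S × W → S` is a homotopy equivalence. -/
theorem nonempty_homotopyEquiv_sphere_prod (V W : Type*) [NormedAddCommGroup V]
    [InnerProductSpace ℝ V] [NormedAddCommGroup W] [InnerProductSpace ℝ W] :
    Nonempty (ContinuousMap.HomotopyEquiv (sphere (0 : V) 1 × W) (sphere (0 : V) 1)) := by
  obtain ⟨e⟩ := ContractibleSpace.hequiv_unit W
  exact ⟨((ContinuousMap.HomotopyEquiv.refl _).prodCongr e).trans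
    (Homeomorph.prodPUnit (sphere (0 : V) 1)).toHomotopyEquiv⟩

theorem not_contractibleSpace_sphere_prod [FiniteDimensional ℝ V] :
    ¬ ContractibleSpace (sphere (0 : V) 1 × W) := by
  intro h
  obtain ⟨e⟩ := nonempty_homotopyEquiv_sphere_prod V W
  have := e.symm.contractibleSpace
  exact not_nullhomotopic_id_sphere (id_nullhomotopic (sphere (0 : V) 1))

theorem finrank_le_of_sphere_homotopyEquiv [FiniteDimensional ℝ V] [FiniteDimensional ℝ W]
    (e : ContinuousMap.HomotopyEquiv (sphere (0 : V) 1) (sphere (0 : W) 1)) :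
    Module.finrank ℝ W ≤ Module.finrank ℝ V := by
  by_contra! h
  obtain ⟨y, hy⟩ := (nullhomotopic_of_finrank_lt h e.toFun).comp_right e.invFun
  exact not_nullhomotopic_id_sphere ⟨y, e.left_inv.symm.trans hy⟩

/-- The dimension of the sphere factor of `S × ℝᵃ` is a topological invariant. -/
theorem finrank_eq_of_sphere_prod_homeomorph {V' W' : Type*} [NormedAddCommGroup V']
    [InnerProductSpace ℝ V'] [NormedAddCommGroup W'] [InnerProductSpace ℝ W']
    [FiniteDimensional ℝ V] [FiniteDimensional ℝ W]
    (e : (sphere (0 : V) 1 × V') ≃ₜ (sphere (0 : W) 1 × W')) :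
    Module.finrank ℝ V = Module.finrank ℝ W := by
  obtain ⟨a⟩ := nonempty_homotopyEquiv_sphere_prod V V'
  obtain ⟨b⟩ := nonempty_homotopyEquiv_sphere_prod W W'
  let E := (a.symm.trans e.toHomotopyEquiv).trans b
  exact le_antisymm (finrank_le_of_sphere_homotopyEquiv E.symm)
    (finrank_le_of_sphere_homotopyEquiv E)

end Spheres

section Structure

open Metric Set Filter

variable {n m : ℕ} {K : Set (E n)} {L : Submodule ℝ (E n)}

/-! ### Recession cones and cylinders with bounded cross-section -/

theorem mem_asymptoticCone_of_ray {x v : E n} (h : ∀ k : ℕ, x + (k : ℝ) • v ∈ K) :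
    v ∈ asymptoticCone ℝ K := by
  rw [mem_asymptoticCone_iff]
  have ht : Tendsto (fun k : ℕ => (k : ℝ) • v +ᵥ x) atTop
      (AffineSpace.asymptoticNhds ℝ (E n) v) :=
    (Tendsto.atTop_smul_const_tendsto_asymptoticNhds v
      tendsto_natCast_atTop_atTop).asymptoticNhds_vadd_const x
  exact ht.frequently (Frequently.of_forall fun k => by
    rw [vadd_eq_add, add_comm]; exact h k)

theorem add_natCast_smul_mem {x v : E n} (hv : v ∈ recessionCone K) (hx : x ∈ K) (k : ℕ) :
    x + (k : ℝ) • v ∈ K := by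
  induction k with
  | zero => simpa using hx
  | succ k ih =>
    rw [Nat.cast_succ, add_smul, one_smul, ← add_assoc]
    exact hv _ ih

/-- The recession cone of a nonempty closed convex set is its asymptotic cone. -/
theorem recessionCone_eq_asymptoticCone (hK : IsClosed K) (hc : Convex ℝ K) (hne : K.Nonempty) :
    recessionCone K = asymptoticCone ℝ K := by
  ext v
  refine ⟨fun hv => ?_, fun hv x hx => ?_⟩
  · obtain ⟨x, hx⟩ := hne
    exact mem_asymptoticCone_of_ray (add_natCast_smul_mem hv hx)
  · simpa [add_comm] using
      hc.smul_vadd_mem_of_isClosed_of_mem_asymptoticCone hK zero_le_one hv hx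

/-- `K` is invariant under translations by `L`, and its projection to the orthogonal complement of
`L` is bounded. -/
structure IsCylinderOver (K : Set (E n)) (L : Submodule ℝ (E n)) : Prop where
  add_mem : ∀ x ∈ K, ∀ l ∈ L, x + l ∈ K
  bounded : ∃ R, ∀ x ∈ K, ‖Lᗮ.starProjection x‖ ≤ R

theorem IsCylinderOver.recessionCone_eq (h : IsCylinderOver K L) (hne : K.Nonempty) :
    recessionCone K = L := by
  ext v
  refine ⟨fun hv => ?_, fun hv x hx => h.add_mem x hx v hv⟩
  obtain ⟨x, hx⟩ := hne
  obtain ⟨R, hR⟩ := h.bounded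
  have hmem : ∀ k : ℕ, x + (k : ℝ) • v ∈ K := add_natCast_smul_mem hv hx
  have hbd : ∀ k : ℕ, (k : ℝ) * ‖Lᗮ.starProjection v‖ ≤ 2 * R := by
    intro k
    have h1 : (k : ℝ) • Lᗮ.starProjection v =
        Lᗮ.starProjection (x + (k : ℝ) • v) - Lᗮ.starProjection x := by
      rw [map_add, map_smul]; abel
    have h2 : (k : ℝ) * ‖Lᗮ.starProjection v‖ = ‖(k : ℝ) • Lᗮ.starProjection v‖ := by
      rw [norm_smul, Real.norm_of_nonneg (Nat.cast_nonneg k)]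
    rw [h2, h1]
    linarith [norm_sub_le (Lᗮ.starProjection (x + (k : ℝ) • v)) (Lᗮ.starProjection x),
      hR _ (hmem k), hR _ hx]
  have h0 : Lᗮ.starProjection v = 0 := by
    by_contra h0
    obtain ⟨k, hk⟩ := exists_nat_gt (2 * R / ‖Lᗮ.starProjection v‖)
    rw [div_lt_iff₀ (norm_pos_iff.2 h0)] at hk
    linarith [hbd k]
  rw [Submodule.starProjection_apply_eq_zero_iff] at h0
  simpa using h0

/-- A closed convex set whose recession cone is a linear subspace `L` is the sum of `L` and a
bounded set. -/
theorem isCylinderOver_of_recessionCone_eq (hK : IsClosed K) (hc : Convex ℝ K)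
    (h : recessionCone K = L) : IsCylinderOver K L := by
  have hadd : ∀ x ∈ K, ∀ l ∈ L, x + l ∈ K := fun x hx l hl =>
    (h.symm ▸ hl : l ∈ recessionCone K) x hx
  refine ⟨hadd, ?_⟩
  have hproj : ∀ x ∈ K, Lᗮ.starProjection x ∈ K ∩ Lᗮ := by
    intro x hx
    refine ⟨?_, Submodule.starProjection_apply_mem _ _⟩
    rw [Submodule.starProjection_orthogonal_val, sub_eq_add_neg]
    exact hadd x hx _ (L.neg_mem (Submodule.starProjection_apply_mem _ _))
  have hbdd : Bornology.IsBounded (K ∩ Lᗮ) := by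
    rw [isBounded_iff_asymptoticCone_subset_singleton]
    intro v hv
    have hv1 : v ∈ asymptoticCone ℝ K := asymptoticCone_mono inter_subset_left hv
    have hv2 : v ∈ asymptoticCone ℝ (Lᗮ : Set (E n)) := asymptoticCone_mono inter_subset_right hv
    rw [asymptoticCone_submodule, (Submodule.closed_of_finiteDimensional Lᗮ).closure_eq] at hv2
    have hne : K.Nonempty := asymptoticCone_nonempty.1 ⟨v, hv1⟩
    rw [← recessionCone_eq_asymptoticCone hK hc hne, h] at hv1
    exact (Submodule.disjoint_def.1 L.orthogonal_disjoint) v hv1 hv2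
  obtain ⟨R, hR⟩ := hbdd.exists_norm_le
  exact ⟨R, fun x hx => hR _ (hproj x hx)⟩

/-! ### The boundary of a convex body through its gauge -/

/-- The gauge of `K` about an interior point `x₀` vanishes exactly on the recession cone. -/
theorem gauge_translate_eq_zero_iff {x₀ : E n} (hK : IsClosed K) (hc : Convex ℝ K)
    (hx₀ : x₀ ∈ interior K) (y : E n) :
    gauge ((fun y => x₀ + y) ⁻¹' K) y = 0 ↔ y ∈ recessionCone K := by
  have hx₀K := interior_subset hx₀
  set s := (fun y => x₀ + y) ⁻¹' K
  have hs : s ∈ 𝓝 (0 : E n) := by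
    refine (continuous_const_add x₀).continuousAt.preimage_mem_nhds ?_
    simpa using mem_interior_iff_mem_nhds.1 hx₀
  have hsc : Convex ℝ s := hc.translate_preimage_right x₀
  have hscl : IsClosed s := hK.preimage (continuous_const_add x₀)
  rw [recessionCone_eq_asymptoticCone hK hc ⟨x₀, hx₀K⟩]
  constructor
  · intro h
    refine mem_asymptoticCone_of_ray (x := x₀) fun k => ?_
    have hg : gauge s ((k : ℝ) • y) = 0 := by
      rw [gauge_smul_of_nonneg (Nat.cast_nonneg k), h, smul_zero]
    have h1 : (k : ℝ) • y ∈ closure s := (gauge_le_one_iff_mem_closure hsc hs).1 (by rw [hg]; simp)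
    rwa [hscl.closure_eq] at h1
  · intro hy
    have hle : ∀ k : ℕ, (k : ℝ) * gauge s y ≤ 1 := by
      intro k
      have : (k : ℝ) • y ∈ s := by
        have := hc.smul_vadd_mem_of_isClosed_of_mem_asymptoticCone hK (Nat.cast_nonneg k) hy hx₀K
        rw [vadd_eq_add, add_comm] at this
        exact this
      simpa [gauge_smul_of_nonneg (Nat.cast_nonneg k : (0 : ℝ) ≤ k)] using gauge_le_one_of_mem this
    by_contra hne
    have hpos : 0 < gauge s y := lt_of_le_of_ne (gauge_nonneg y) (Ne.symm hne)
    obtain ⟨k, hk⟩ := exists_nat_gt (1 / gauge s y)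
    rw [div_lt_iff₀ hpos] at hk
    linarith [hle k]

/-- The gauge of `K` about an interior point `x₀` equals one exactly on the boundary of `K`. -/
theorem gauge_translate_eq_one_iff {x₀ : E n} (hc : Convex ℝ K)
    (hx₀ : x₀ ∈ interior K) (y : E n) :
    gauge ((fun y => x₀ + y) ⁻¹' K) y = 1 ↔ x₀ + y ∈ frontier K := by
  have hs : (fun y => x₀ + y) ⁻¹' K ∈ 𝓝 (0 : E n) := by
    refine (continuous_const_add x₀).continuousAt.preimage_mem_nhds ?_
    simpa using mem_interior_iff_mem_nhds.1 hx₀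
  rw [gauge_eq_one_iff_mem_frontier (hc.translate_preimage_right x₀) hs]
  have := (Homeomorph.addLeft x₀).preimage_frontier K
  exact (Set.ext_iff.1 this y).symm

theorem continuous_gauge_translate {x₀ : E n} (hc : Convex ℝ K) (hx₀ : x₀ ∈ interior K) :
    Continuous (gauge ((fun y => x₀ + y) ⁻¹' K)) := by
  refine continuous_gauge (hc.translate_preimage_right x₀) ?_
  refine (continuous_const_add x₀).continuousAt.preimage_mem_nhds ?_
  simpa using mem_interior_iff_mem_nhds.1 hx₀

/-- Radial projection from an interior point `x₀` onto the boundary of `K`. -/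
theorem radial_mem_frontier {x₀ : E n} (hK : IsClosed K) (hc : Convex ℝ K)
    (hx₀ : x₀ ∈ interior K) {y : E n} (hy : y ∉ recessionCone K) :
    x₀ + (gauge ((fun y => x₀ + y) ⁻¹' K) y)⁻¹ • y ∈ frontier K := by
  rw [← gauge_translate_eq_one_iff hc hx₀,
    gauge_smul_of_nonneg (inv_nonneg.2 (gauge_nonneg y)), smul_eq_mul, inv_mul_cancel₀]
  exact fun h => hy ((gauge_translate_eq_zero_iff hK hc hx₀ y).1 h)

/-- If the recession cone is not a linear subspace, then the boundary is contractible: it is a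
retract of the complement of the recession cone, which is star-shaped. -/
theorem contractibleSpace_frontier (hK : IsClosed K) (hc : Convex ℝ K)
    (hint : (interior K).Nonempty) {v : E n} (hv : v ∈ recessionCone K)
    (hnv : -v ∉ recessionCone K) : ContractibleSpace (frontier K) := by
  obtain ⟨x₀, hx₀⟩ := hint
  have hx₀K := interior_subset hx₀
  set g := gauge ((fun y => x₀ + y) ⁻¹' K) with hg
  have hrc := recessionCone_eq_asymptoticCone hK hc ⟨x₀, hx₀K⟩
  have hadd : ∀ a ∈ recessionCone K, ∀ b ∈ recessionCone K, a + b ∈ recessionCone K :=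
    fun a ha b hb x hx => by rw [← add_assoc]; exact hb _ (ha x hx)
  have hsmul : ∀ a ∈ recessionCone K, ∀ c : ℝ, 0 ≤ c → c • a ∈ recessionCone K :=
    fun a ha c hc => by rw [hrc] at ha ⊢; exact smul_mem_asymptoticCone hc ha
  -- If `-a v + b u` is in the recession cone, then so is `u`, by adding `a v`.
  have hstar : StarConvex ℝ (-v) (recessionCone K)ᶜ := by
    intro u hu a b ha hb hab hmem
    rcases hb.eq_or_lt with rfl | hb0
    · simp only [add_zero] at hab
      exact hnv (by simpa [hab] using hmem)
    · apply hu
      have h1 := hsmul _ (hadd _ hmem _ (hsmul v hv a ha)) b⁻¹ (inv_nonneg.2 hb)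
      have h2 : b⁻¹ • (a • -v + b • u + a • v) = u := by
        rw [show a • -v + b • u + a • v = b • u by rw [smul_neg]; abel, smul_smul,
          inv_mul_cancel₀ hb0.ne', one_smul]
      rwa [h2] at h1
  have hY := hstar.contractibleSpace ⟨-v, hnv⟩
  let ι : C(frontier K, ((recessionCone K)ᶜ : Set (E n))) :=
    ⟨fun x => ⟨x.1 - x₀, fun hmem => by
      have h1 := (gauge_translate_eq_zero_iff hK hc hx₀ _).2 hmem
      have h2 := (gauge_translate_eq_one_iff hc hx₀ (x.1 - x₀)).2 (by simp)
      linarith⟩, by fun_prop⟩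
  let ρ : C(((recessionCone K)ᶜ : Set (E n)), frontier K) :=
    ⟨fun y => ⟨x₀ + (g y)⁻¹ • y.1, radial_mem_frontier hK hc hx₀ y.2⟩, by
      have h1 : Continuous fun y : ((recessionCone K)ᶜ : Set (E n)) => (g y)⁻¹ :=
        ((continuous_gauge_translate hc hx₀).comp continuous_subtype_val).inv₀ fun y h =>
          y.2 ((gauge_translate_eq_zero_iff hK hc hx₀ y.1).1 h)
      exact (continuous_const.add (h1.smul continuous_subtype_val)).subtype_mk _⟩
  have hρι : ρ.comp ι = ContinuousMap.id _ := by
    ext x : 2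
    have h2 : g (x.1 - x₀) = 1 := (gauge_translate_eq_one_iff hc hx₀ (x.1 - x₀)).2 (by simp)
    simp [ρ, ι, h2]
  rw [contractible_iff_id_nullhomotopic, ← hρι]
  exact ((id_nullhomotopic ((recessionCone K)ᶜ : Set (E n))).comp_left ι).comp_right ρ

/-- The boundary of a convex body which is a cylinder over `L` with bounded cross-section is
homeomorphic to the product of a sphere and `L`. -/
theorem nonempty_frontier_homeomorph (hK : IsClosed K) (hc : Convex ℝ K)
    (hint : (interior K).Nonempty) (h : IsCylinderOver K L) :
    Nonempty (frontier K ≃ₜ sphere (0 : Lᗮ) 1 × L) := by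
  obtain ⟨x₀, hx₀⟩ := hint
  have hx₀K := interior_subset hx₀
  have hrc := h.recessionCone_eq ⟨x₀, hx₀K⟩
  set g := gauge ((fun y => x₀ + y) ⁻¹' K) with hg
  -- The gauge `g` about `x₀` is invariant under translations by `L`.
  have hgL : ∀ y, ∀ l ∈ L, g (y + l) = g y := by
    intro y l hl
    rw [hg, gauge_def', gauge_def']
    congr 1
    ext r
    refine and_congr_right fun _ => ?_
    simp only [mem_preimage, smul_add, ← add_assoc]
    refine ⟨fun hh => ?_, fun hh => h.add_mem _ hh _ (L.smul_mem _ hl)⟩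
    simpa using h.add_mem _ hh _ (L.neg_mem (L.smul_mem r⁻¹ hl))
  have hg0 : ∀ y, g y = 0 ↔ y ∈ L := fun y => by
    rw [hg, gauge_translate_eq_zero_iff hK hc hx₀, hrc]; rfl
  have hg1 : ∀ y, g y = 1 ↔ x₀ + y ∈ frontier K := gauge_translate_eq_one_iff hc hx₀
  have hgc : Continuous g := continuous_gauge_translate hc hx₀
  have hdecomp : ∀ y : E n,
      (Lᗮ.orthogonalProjectionOnto y : E n) + (L.orthogonalProjectionOnto y : E n) = y :=
    fun y => by
    rw [add_comm]
    exact L.starProjection_add_starProjection_orthogonal y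
  have hgp : ∀ y, g (Lᗮ.orthogonalProjectionOnto y : E n) = g y := fun y => by
    conv_rhs => rw [← hdecomp y, hgL _ _ (L.orthogonalProjectionOnto y).2]
  have hne : ∀ x : frontier K, Lᗮ.orthogonalProjectionOnto (x.1 - x₀) ≠ 0 := by
    intro x h0
    have h1 : g (x.1 - x₀) = 1 := (hg1 _).2 (by simp)
    rw [← hgp, h0] at h1
    simp [hg] at h1
  have hu0 : ∀ u : sphere (0 : Lᗮ) 1, g (u.1 : E n) ≠ 0 := by
    intro u hu
    have h1 := (hg0 _).1 hu
    have h2 := (Submodule.disjoint_def.1 L.orthogonal_disjoint) _ h1 u.1.2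
    have h3 := norm_eq_of_mem_sphere u
    rw [show u.1 = 0 from Subtype.ext h2] at h3
    simp at h3
  refine ⟨{ toFun := fun x => (toSphere ⟨_, hne x⟩, L.orthogonalProjectionOnto (x.1 - x₀))
            invFun := fun p => ⟨x₀ + ((g (p.1.1 : E n))⁻¹ • (p.1.1 : E n) + (p.2 : E n)), ?_⟩
            left_inv := ?_
            right_inv := ?_
            continuous_toFun := ?_
            continuous_invFun := ?_ }⟩
  · rw [← hg1, hgL _ _ p.2.2, hg, gauge_smul_of_nonneg (inv_nonneg.2 (gauge_nonneg _)),
      smul_eq_mul, inv_mul_cancel₀ (hu0 p.1)]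
  · intro x
    ext1
    have h1 : g (x.1 - x₀) = 1 := (hg1 _).2 (by simp)
    have h2 : ‖Lᗮ.orthogonalProjectionOnto (x.1 - x₀)‖ ≠ 0 := norm_ne_zero_iff.2 (hne x)
    have h3 : g ((toSphere ⟨_, hne x⟩ : Lᗮ) : E n) =
        ‖Lᗮ.orthogonalProjectionOnto (x.1 - x₀)‖⁻¹ := by
      rw [toSphere_coe, Submodule.coe_smul, hg,
        gauge_smul_of_nonneg (inv_nonneg.2 (norm_nonneg _)), ← hg, hgp, h1, smul_eq_mul, mul_one]
    simp only
    rw [h3, inv_inv, toSphere_coe, Submodule.coe_smul, smul_smul, mul_inv_cancel₀ h2, one_smul,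
      hdecomp, add_sub_cancel]
  · rintro ⟨u, l⟩
    have hgu : 0 < g (u.1 : E n) := lt_of_le_of_ne (gauge_nonneg _) (Ne.symm (hu0 u))
    have e1 : Lᗮ.orthogonalProjectionOnto ((g (u.1 : E n))⁻¹ • (u.1 : E n) + (l : E n)) =
        (g (u.1 : E n))⁻¹ • u.1 := by
      rw [map_add, map_smul, Submodule.orthogonalProjectionOnto_mem_subspace_eq_self,
        Submodule.orthogonalProjectionOnto_orthogonal_apply_eq_zero l.2, add_zero]
    have e2 : L.orthogonalProjectionOnto ((g (u.1 : E n))⁻¹ • (u.1 : E n) + (l : E n)) = l := by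
      rw [map_add, map_smul, Submodule.orthogonalProjectionOnto_mem_subspace_eq_self,
        Submodule.orthogonalProjectionOnto_apply_of_mem_orthogonal u.1.2, smul_zero, zero_add]
    refine Prod.ext ?_ ?_
    · ext1
      simp only [toSphere_coe, add_sub_cancel_left, e1]
      rw [norm_smul, norm_eq_of_mem_sphere, mul_one, Real.norm_of_nonneg (inv_nonneg.2 hgu.le),
        inv_inv, smul_smul, mul_inv_cancel₀ hgu.ne', one_smul]
    · simp only [add_sub_cancel_left, e2]
  · refine Continuous.prodMk (toSphere.continuous.comp (Continuous.subtype_mk ?_ _)) ?_ <;> fun_prop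
  · have h1 : Continuous fun p : sphere (0 : Lᗮ) 1 × L => (p.1.1 : E n) := by fun_prop
    have h2 : Continuous fun p : sphere (0 : Lᗮ) 1 × L => (p.2 : E n) := by fun_prop
    have h3 : Continuous fun p : sphere (0 : Lᗮ) 1 × L => (g (p.1.1 : E n))⁻¹ :=
      (hgc.comp h1).inv₀ fun p => hu0 p.1
    exact (continuous_const.add ((h3.smul h1).add h2)).subtype_mk _

theorem nonempty_sphere_homeomorph {V W : Type*} [NormedAddCommGroup V] [InnerProductSpace ℝ V]
    [NormedAddCommGroup W] [InnerProductSpace ℝ W] [FiniteDimensional ℝ V] [FiniteDimensional ℝ W]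
    (h : Module.finrank ℝ V = Module.finrank ℝ W) :
    Nonempty (sphere (0 : V) 1 ≃ₜ sphere (0 : W) 1) ∧ Nonempty (V ≃ₜ W) := by
  let e := (stdOrthonormalBasis ℝ V).equiv (stdOrthonormalBasis ℝ W) (finCongr h)
  exact ⟨⟨e.toHomeomorph.subtype fun x => by simp⟩, ⟨e.toHomeomorph⟩⟩

theorem finrank_orthogonal (L : Submodule ℝ (E n)) :
    Module.finrank ℝ Lᗮ = n - Module.finrank ℝ L := by
  have := L.finrank_add_finrank_orthogonal
  rw [finrank_euclideanSpace_fin] at this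
  omega

theorem finrank_le (L : Submodule ℝ (E n)) : Module.finrank ℝ L ≤ n := by
  have := L.finrank_le
  rwa [finrank_euclideanSpace_fin] at this

/-- The recession cone of a member of `𝒦ⁿᵐ` is a linear subspace of dimension `m`. -/
theorem exists_recessionCone_eq_of_mem_bodies (hmn : m < n) {K : ClosedConvexSet n}
    (hK : K ∈ bodies n m) :
    ∃ L : Submodule ℝ (E n), recessionCone K.carrier = L ∧ Module.finrank ℝ L = m := by
  obtain ⟨hint, -, -, ⟨e⟩⟩ := hK
  have hrc := recessionCone_eq_asymptoticCone K.isClosed K.convex K.nonempty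
  by_cases hlin : ∀ v ∈ recessionCone K.carrier, -v ∈ recessionCone K.carrier
  · let L : Submodule ℝ (E n) :=
      { carrier := recessionCone K.carrier
        add_mem' := fun {a b} ha hb x hx => by rw [← add_assoc]; exact hb _ (ha x hx)
        zero_mem' := zero_mem_recessionCone _
        smul_mem' := fun c a ha => by
          rcases le_total 0 c with hc | hc
          · rw [hrc] at ha ⊢; exact smul_mem_asymptoticCone hc ha
          · have h1 := hlin a ha
            rw [hrc] at h1 ⊢
            have := smul_mem_asymptoticCone (neg_nonneg.2 hc) h1
            rwa [neg_smul_neg] at this }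
    refine ⟨L, rfl, ?_⟩
    obtain ⟨e'⟩ := nonempty_frontier_homeomorph K.isClosed K.convex hint
      (isCylinderOver_of_recessionCone_eq (L := L) K.isClosed K.convex rfl)
    have h1 := finrank_eq_of_sphere_prod_homeomorph (e'.symm.trans e)
    rw [finrank_orthogonal, finrank_euclideanSpace_fin] at h1
    have := finrank_le L
    omega
  · push Not at hlin
    obtain ⟨v, hv, hnv⟩ := hlin
    have := contractibleSpace_frontier K.isClosed K.convex hint hv hnv
    exact absurd e.symm.contractibleSpace not_contractibleSpace_sphere_prod

theorem mem_bodies_of_isCylinderOver (hm : 1 ≤ m) (hmn : m < n) {K : ClosedConvexSet n}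
    (hint : (interior K.carrier).Nonempty) (h : IsCylinderOver K.carrier L)
    (hL : Module.finrank ℝ L = m) : K ∈ bodies n m := by
  have hrc := h.recessionCone_eq K.nonempty
  refine ⟨hint, fun hb => ?_, fun huniv => ?_, ?_⟩
  · have h1 := isBounded_iff_asymptoticCone_subset_singleton.1 hb
    rw [← recessionCone_eq_asymptoticCone K.isClosed K.convex K.nonempty, hrc] at h1
    have h2 : L = ⊥ := (Submodule.eq_bot_iff L).2 fun x hx => h1 hx
    rw [h2, finrank_bot] at hL
    omega
  · have h2 : L = ⊤ := by
      refine SetLike.coe_injective ?_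
      rw [← hrc, huniv]
      ext v; simp [recessionCone]
    rw [h2, finrank_top, finrank_euclideanSpace_fin] at hL
    omega
  · obtain ⟨e⟩ := nonempty_frontier_homeomorph K.isClosed K.convex hint h
    obtain ⟨e1⟩ := (nonempty_sphere_homeomorph (V := Lᗮ) (W := E (n - m))
      (by rw [finrank_orthogonal, hL, finrank_euclideanSpace_fin])).1
    obtain ⟨e2⟩ := (nonempty_sphere_homeomorph (V := L) (W := E m)
      (by rw [hL, finrank_euclideanSpace_fin])).2
    exact ⟨e.trans (e1.prodCongr e2)⟩

end Structure

section Deformation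

open Metric Set Filter

variable {n m : ℕ} {K K' : Set (E n)} {L L' : Submodule ℝ (E n)}

/-! ### The deformation -/

/-- The set `(1 - t) K + rc K`. For a nonempty closed convex set `K` it equals `(1 - t) K` if
`t < 1` and `rc K` if `t = 1`. -/
def shrink (K : Set (E n)) (t : ℝ) : Set (E n) :=
  {x | ∃ a ∈ K, ∃ l ∈ recessionCone K, x = (1 - t) • a + l}

theorem convex_recessionCone (hc : Convex ℝ K) : Convex ℝ (recessionCone K) := by
  intro u hu v hv a b ha hb hab x hx
  have := hc (hu x hx) (hv x hx) ha hb hab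
  have e : a • (x + u) + b • (x + v) = x + (a • u + b • v) := by
    rw [smul_add, smul_add, add_add_add_comm, ← add_smul, hab, one_smul]
  rwa [e] at this

theorem convex_shrink (hc : Convex ℝ K) (t : ℝ) : Convex ℝ (shrink K t) := by
  rintro _ ⟨a, ha, l, hl, rfl⟩ _ ⟨a', ha', l', hl', rfl⟩ p q hp hq hpq
  refine ⟨p • a + q • a', hc ha ha' hp hq hpq, p • l + q • l',
    convex_recessionCone hc hl hl' hp hq hpq, ?_⟩
  rw [smul_add (1 - t), smul_add, smul_add, smul_comm p, smul_comm q]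
  abel

/-- The deformation of convex sets underlying the theorem, at time `t`: the sum of `(1 - t) K`, the
recession cone of `K` and the ball of radius `t`, expressed as a closed thickening. -/
def flow (K : ClosedConvexSet n) (t : I) : ClosedConvexSet n where
  carrier := cthickening t (shrink K.carrier t)
  isClosed := isClosed_cthickening
  convex := (convex_shrink K.convex t).cthickening t
  nonempty := by
    obtain ⟨x, hx⟩ := K.nonempty
    exact ⟨_, self_subset_cthickening _
      ⟨x, hx, 0, zero_mem_recessionCone _, rfl⟩⟩

theorem shrink_one (h : IsCylinderOver K L) (hne : K.Nonempty) : shrink K 1 = L := by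
  ext x
  simp only [shrink, h.recessionCone_eq hne, sub_self, zero_smul, zero_add]
  refine ⟨?_, fun hx => ⟨hne.some, hne.some_mem, x, hx, rfl⟩⟩
  rintro ⟨a, -, l, hl, rfl⟩
  exact hl

theorem mem_shrink_iff_of_lt (h : IsCylinderOver K L) {t : ℝ} (ht : t < 1) (x : E n) :
    x ∈ shrink K t ↔ (1 - t)⁻¹ • x ∈ K := by
  have ht' : 1 - t ≠ 0 := by linarith
  constructor
  · rintro ⟨a, ha, l, hl, rfl⟩
    rw [h.recessionCone_eq ⟨a, ha⟩] at hl
    rw [smul_add, smul_smul, inv_mul_cancel₀ ht', one_smul]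
    exact h.add_mem a ha _ (L.smul_mem _ hl)
  · intro hx
    refine ⟨_, hx, 0, zero_mem_recessionCone _, ?_⟩
    rw [smul_smul, mul_inv_cancel₀ ht', one_smul, add_zero]

theorem isClosed_shrink (h : IsCylinderOver K L) (hne : K.Nonempty) (hK : IsClosed K) {t : ℝ}
    (ht : t ≤ 1) : IsClosed (shrink K t) := by
  rcases ht.eq_or_lt with rfl | ht
  · rw [shrink_one h hne]
    exact Submodule.closed_of_finiteDimensional L
  · have : shrink K t = (fun x => (1 - t)⁻¹ • x) ⁻¹' K := by
      ext x; exact mem_shrink_iff_of_lt h ht x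
    rw [this]
    exact hK.preimage (continuous_const_smul _)

/-- The closed thickening is the sum of `(1 - t) K`, `L` and `t B`, because the set being thickened
is closed. -/
theorem mem_flow_iff {K : ClosedConvexSet n} (h : IsCylinderOver K.carrier L) (t : I) (x : E n) :
    x ∈ (flow K t).carrier ↔
      ∃ a ∈ K.carrier, ∃ l ∈ L, ∃ b, ‖b‖ ≤ 1 ∧ x = (1 - (t : ℝ)) • a + l + (t : ℝ) • b := by
  have h1 : x ∈ (flow K t).carrier ↔ ∃ y ∈ shrink K.carrier t, ‖x - y‖ ≤ t := by
    change x ∈ cthickening (t : ℝ) _ ↔ _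
    rw [(isClosed_shrink h K.nonempty K.isClosed t.2.2).cthickening_eq_biUnion_closedBall t.2.1]
    simp [dist_eq_norm]
  rw [h1]
  constructor
  · rintro ⟨_, ⟨a, ha, l, hl, rfl⟩, hx⟩
    rw [h.recessionCone_eq K.nonempty] at hl
    refine ⟨a, ha, l, hl, (t : ℝ)⁻¹ • (x - ((1 - (t : ℝ)) • a + l)), ?_, ?_⟩
    · rw [norm_smul, norm_inv, Real.norm_of_nonneg t.2.1]
      exact (mul_le_mul_of_nonneg_left hx (inv_nonneg.2 t.2.1)).trans inv_mul_le_one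
    · rcases eq_or_ne (t : ℝ) 0 with h0 | h0
      · rw [h0] at hx ⊢
        rw [sub_eq_zero.1 (norm_le_zero_iff.1 hx)]
        simp
      · rw [smul_smul, mul_inv_cancel₀ h0, one_smul, add_sub_cancel]
  · rintro ⟨a, ha, l, hl, b, hb, rfl⟩
    refine ⟨_, ⟨a, ha, l, ?_, rfl⟩, ?_⟩
    · rwa [h.recessionCone_eq K.nonempty]
    · rw [add_sub_cancel_left, norm_smul, Real.norm_of_nonneg t.2.1]
      exact mul_le_of_le_one_right t.2.1 hb

theorem IsCylinderOver.starProjection_orthogonal_mem (h : IsCylinderOver K L) {x : E n}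
    (hx : x ∈ K) : Lᗮ.starProjection x ∈ K := by
  rw [Submodule.starProjection_orthogonal_val, sub_eq_add_neg]
  exact h.add_mem x hx _ (L.neg_mem (Submodule.starProjection_apply_mem _ _))

/-- A point of the deformed set can be written with the summands from `K` and the ball orthogonal
to `L`. -/
theorem exists_of_mem_flow {K : ClosedConvexSet n} (h : IsCylinderOver K.carrier L) {t : I}
    {x : E n} (hx : x ∈ (flow K t).carrier) :
    ∃ a ∈ K.carrier, Lᗮ.starProjection a = a ∧ ∃ b, Lᗮ.starProjection b = b ∧ ‖b‖ ≤ 1 ∧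
      x = (1 - (t : ℝ)) • a + L.starProjection x + (t : ℝ) • b := by
  obtain ⟨a, ha, l, hl, b, hb, rfl⟩ := (mem_flow_iff h t x).1 hx
  have hidem : ∀ y, Lᗮ.starProjection (Lᗮ.starProjection y) = Lᗮ.starProjection y := fun y =>
    Submodule.starProjection_eq_self_iff.2 (Submodule.starProjection_apply_mem _ _)
  refine ⟨_, h.starProjection_orthogonal_mem ha, hidem a, _, hidem b,
    (Submodule.norm_starProjection_apply_le _ _).trans hb, ?_⟩
  set y := (1 - (t : ℝ)) • a + l + (t : ℝ) • b with hy
  have h1 : Lᗮ.starProjection y =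
      (1 - (t : ℝ)) • Lᗮ.starProjection a + (t : ℝ) • Lᗮ.starProjection b := by
    rw [hy, map_add, map_add, map_smul, map_smul,
      Submodule.starProjection_orthogonal_apply_eq_zero hl, add_zero]
  conv_lhs => rw [← L.starProjection_add_starProjection_orthogonal y, h1]
  abel

theorem IsCylinderOver.flow {K : ClosedConvexSet n} (h : IsCylinderOver K.carrier L) (t : I) :
    IsCylinderOver (flow K t).carrier L := by
  refine ⟨fun x hx l hl => ?_, ?_⟩
  · obtain ⟨a, ha, l', hl', b, hb, rfl⟩ := (mem_flow_iff h t x).1 hx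
    refine (mem_flow_iff h t _).2 ⟨a, ha, l' + l, L.add_mem hl' hl, b, hb, by abel⟩
  · obtain ⟨R, hR⟩ := h.bounded
    refine ⟨(1 - t) * R + t * 1, fun x hx => ?_⟩
    obtain ⟨a, ha, haL, b, hbL, hb, hxe⟩ := exists_of_mem_flow h hx
    have h1 : Lᗮ.starProjection x = (1 - (t : ℝ)) • a + (t : ℝ) • b := by
      conv_lhs => rw [hxe]
      rw [map_add, map_add, map_smul, map_smul, haL, hbL,
        Submodule.starProjection_orthogonal_apply_eq_zero (Submodule.starProjection_apply_mem _ _),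
        add_zero]
    rw [h1]
    refine (norm_add_le _ _).trans ?_
    rw [norm_smul, norm_smul, Real.norm_of_nonneg t.2.1, Real.norm_of_nonneg (sub_nonneg.2 t.2.2)]
    have h2 := hR a ha
    rw [haL] at h2
    exact add_le_add (mul_le_mul_of_nonneg_left h2 (sub_nonneg.2 t.2.2))
      (mul_le_mul_of_nonneg_left hb t.2.1)

theorem flow_zero {K : ClosedConvexSet n} (h : IsCylinderOver K.carrier L) : flow K 0 = K := by
  ext x
  rw [mem_flow_iff h]
  simp only [Set.Icc.coe_zero, sub_zero, one_smul, zero_smul, add_zero]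
  constructor
  · rintro ⟨a, ha, l, hl, b, -, rfl⟩
    exact h.add_mem a ha l hl
  · exact fun hx => ⟨x, hx, 0, L.zero_mem, 0, by simp, by simp⟩

theorem interior_flow_nonempty {K : ClosedConvexSet n} (h : IsCylinderOver K.carrier L)
    (hint : (interior K.carrier).Nonempty) (t : I) : (interior (flow K t).carrier).Nonempty := by
  rcases eq_or_ne t 0 with rfl | ht
  · rwa [flow_zero h]
  · have ht0 : (0 : ℝ) < t := unitInterval.coe_pos.2 (unitInterval.pos_iff_ne_zero.2 ht)
    obtain ⟨x, hx⟩ := K.nonempty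
    set y := (1 - (t : ℝ)) • x + 0
    have hy : y ∈ shrink K.carrier t := ⟨x, hx, 0, zero_mem_recessionCone _, rfl⟩
    exact ⟨y, interior_mono (thickening_subset_cthickening _ _)
      (by rw [isOpen_thickening.interior_eq]; exact self_subset_thickening ht0 _ hy)⟩

theorem mem_flow_one_iff {K : ClosedConvexSet n} (h : IsCylinderOver K.carrier L) (x : E n) :
    x ∈ (flow K 1).carrier ↔ ‖Lᗮ.starProjection x‖ ≤ 1 := by
  rw [mem_flow_iff h]
  simp only [Set.Icc.coe_one, sub_self, one_smul, zero_smul, zero_add]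
  constructor
  · rintro ⟨-, -, l, hl, b, hb, rfl⟩
    rw [map_add, Submodule.starProjection_orthogonal_apply_eq_zero hl, zero_add]
    exact (Submodule.norm_starProjection_apply_le _ _).trans hb
  · intro hx
    exact ⟨_, K.nonempty.some_mem, _, Submodule.starProjection_apply_mem L x, _, hx,
      (L.starProjection_add_starProjection_orthogonal x).symm⟩

theorem isCylinderOver_of_forall_iff (h : ∀ x, x ∈ K ↔ ‖Lᗮ.starProjection x‖ ≤ 1) :
    IsCylinderOver K L := by
  refine ⟨fun x hx l hl => ?_, 1, fun x hx => (h x).1 hx⟩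
  rw [h, map_add, Submodule.starProjection_orthogonal_apply_eq_zero hl, add_zero, ← h]
  exact hx

/-- Round cylinders do not move. -/
theorem flow_eq_self {K : ClosedConvexSet n}
    (h : ∀ x, x ∈ K.carrier ↔ ‖Lᗮ.starProjection x‖ ≤ 1) (t : I) : flow K t = K := by
  have hcyl := isCylinderOver_of_forall_iff h
  ext x
  constructor
  · intro hx
    obtain ⟨a, ha, haL, b, hbL, hb, hxe⟩ := exists_of_mem_flow hcyl hx
    rw [h, haL] at ha
    have h1 : Lᗮ.starProjection x = (1 - (t : ℝ)) • a + (t : ℝ) • b := by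
      conv_lhs => rw [hxe]
      rw [map_add, map_add, map_smul, map_smul, haL, hbL,
        Submodule.starProjection_orthogonal_apply_eq_zero (Submodule.starProjection_apply_mem _ _),
        add_zero]
    rw [h, h1]
    have := (convex_closedBall (0 : E n) 1) (mem_closedBall_zero_iff.2 ha)
      (mem_closedBall_zero_iff.2 hb) (sub_nonneg.2 t.2.2) t.2.1 (by ring)
    simpa using this
  · intro hx
    refine (mem_flow_iff hcyl t x).2 ⟨x, hx, (t : ℝ) • L.starProjection x,
      L.smul_mem _ (Submodule.starProjection_apply_mem _ _), _, (h x).1 hx, ?_⟩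
    rw [add_assoc, ← smul_add, L.starProjection_add_starProjection_orthogonal, ← add_smul]
    simp

/-! ### The chordal metric -/

/-- The chordal distance between the preimages of `x` and `y` under stereographic projection is
`2 ‖x - y‖ / √((1 + ‖x‖²) (1 + ‖y‖²))`. -/
theorem dist_stereoInv_sq (x y : E n) :
    dist (stereoInv x) (stereoInv y) ^ 2 * ((‖x‖ ^ 2 + 1) * (‖y‖ ^ 2 + 1)) = 4 * ‖x - y‖ ^ 2 := by
  have hx : ‖x‖ ^ 2 + 1 ≠ 0 := by positivity
  have hy : ‖y‖ ^ 2 + 1 ≠ 0 := by positivity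
  have hin : inner ℝ (stereoInv x) (stereoInv y) =
      (4 * inner ℝ x y + (‖x‖ ^ 2 - 1) * (‖y‖ ^ 2 - 1)) / ((‖x‖ ^ 2 + 1) * (‖y‖ ^ 2 + 1)) := by
    rw [PiLp.inner_apply, PiLp.inner_apply, Fin.sum_univ_castSucc]
    simp only [stereoInv_castSucc, stereoInv_last]
    simp only [inner, RCLike.re_to_real, star_trivial]
    rw [add_div, Finset.mul_sum, Finset.sum_div]
    congr 1
    · refine Finset.sum_congr rfl fun i _ => ?_
      field_simp
      ring
    · field_simp
  rw [dist_eq_norm, norm_sub_sq_real, norm_sub_sq_real, norm_stereoInv, norm_stereoInv, hin]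
  field_simp
  ring

theorem dist_stereoInv_le {x y : E n} {ε : ℝ} (hε : 0 ≤ ε) (h : ‖x - y‖ ≤ ε * (1 + ‖x‖)) :
    dist (stereoInv x) (stereoInv y) ≤ 3 * ε := by
  refine abs_le_of_sq_le_sq' ?_ (by positivity) |>.2
  have h1 := dist_stereoInv_sq x y
  have h2 : ‖x - y‖ ^ 2 ≤ (ε * (1 + ‖x‖)) ^ 2 := pow_le_pow_left₀ (norm_nonneg _) h 2
  have h3 : dist (stereoInv x) (stereoInv y) ^ 2 * (‖x‖ ^ 2 + 1) ≤ 4 * ‖x - y‖ ^ 2 := by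
    rw [← h1]
    refine mul_le_mul_of_nonneg_left ?_ (sq_nonneg _)
    nlinarith [sq_nonneg ‖y‖, sq_nonneg ‖x‖]
  have h4 : (1 + ‖x‖) ^ 2 ≤ 2 * (‖x‖ ^ 2 + 1) := by nlinarith [sq_nonneg (1 - ‖x‖)]
  have h5 : dist (stereoInv x) (stereoInv y) ^ 2 * (‖x‖ ^ 2 + 1) ≤
      (3 * ε) ^ 2 * (‖x‖ ^ 2 + 1) := by
    nlinarith [mul_le_mul_of_nonneg_left h4 (sq_nonneg ε), sq_nonneg (ε * ‖x‖), sq_nonneg ε]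
  exact le_of_mul_le_mul_right h5 (by positivity)

/-- On a ball of radius `R`, the Euclidean distance is controlled by the chordal distance; the
second point need not be in the ball. -/
theorem norm_sub_le_of_dist_stereoInv {x y : E n} {δ η R : ℝ} (hδ : 0 ≤ δ) (hη : η ≤ 1)
    (hδη : δ * (1 + 2 * R ^ 2) ≤ η) (hx : ‖x‖ ≤ R)
    (h : dist (stereoInv x) (stereoInv y) ≤ δ) : ‖x - y‖ ≤ η := by
  refine (abs_le_of_sq_le_sq' ?_ (by positivity) |>.2).trans hδη
  have h1 := dist_stereoInv_sq x y
  have hR : 0 ≤ R := (norm_nonneg x).trans hx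
  have hy : ‖y‖ ≤ R + ‖x - y‖ := by
    have := norm_sub_norm_le y x
    rw [norm_sub_rev] at this
    linarith
  have hx2 : ‖x‖ ^ 2 ≤ R ^ 2 := pow_le_pow_left₀ (norm_nonneg _) hx 2
  have hy2 : ‖y‖ ^ 2 ≤ 2 * R ^ 2 + 2 * ‖x - y‖ ^ 2 :=
    (pow_le_pow_left₀ (norm_nonneg _) hy 2).trans (by nlinarith [sq_nonneg (R - ‖x - y‖)])
  have hd2 : dist (stereoInv x) (stereoInv y) ^ 2 ≤ δ ^ 2 := pow_le_pow_left₀ dist_nonneg h 2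
  have h2 : 4 * ‖x - y‖ ^ 2 ≤
      δ ^ 2 * ((R ^ 2 + 1) * (2 * R ^ 2 + 2 * ‖x - y‖ ^ 2 + 1)) := by
    rw [← h1]
    gcongr
  have h3 : δ ^ 2 * (R ^ 2 + 1) ≤ 1 := by
    have h4 : (δ * (1 + 2 * R ^ 2)) ^ 2 ≤ 1 :=
      pow_le_one₀ (by positivity) (hδη.trans hη)
    have h5 : R ^ 2 + 1 ≤ (1 + 2 * R ^ 2) ^ 2 := by nlinarith [sq_nonneg R, sq_nonneg (R ^ 2)]
    calc δ ^ 2 * (R ^ 2 + 1) ≤ δ ^ 2 * (1 + 2 * R ^ 2) ^ 2 :=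
          mul_le_mul_of_nonneg_left h5 (sq_nonneg δ)
      _ ≤ 1 := by rw [← mul_pow]; exact h4
  have h6 : δ ^ 2 * (R ^ 2 + 1) * (2 * ‖x - y‖ ^ 2) ≤ 1 * (2 * ‖x - y‖ ^ 2) :=
    mul_le_mul_of_nonneg_right h3 (by positivity)
  have h7 : δ ^ 2 * ((R ^ 2 + 1) * (2 * R ^ 2 + 1)) ≤ δ ^ 2 * (2 * (1 + 2 * R ^ 2) ^ 2) := by
    refine mul_le_mul_of_nonneg_left ?_ (sq_nonneg δ)
    nlinarith [sq_nonneg R, sq_nonneg (R ^ 2)]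
  nlinarith

theorem exists_norm_sub_le_of_bhDist {A B : Set (E n)} {δ η R : ℝ} (hA : A.Nonempty)
    (hB : B.Nonempty) (hη : η ≤ 1) (hδη : δ * (1 + 2 * R ^ 2) ≤ η) (h : bhDist A B < δ) :
    ∀ x ∈ A, ‖x‖ ≤ R → ∃ y ∈ B, ‖x - y‖ ≤ η := by
  intro x hx hxR
  obtain ⟨_, ⟨y, hy, rfl⟩, hxy⟩ := exists_dist_lt_of_hausdorffDist_lt
    (mem_image_of_mem stereoInv hx) h (hausdorffEDist_stereoLift_ne_top hA hB)
  exact ⟨y, hy, norm_sub_le_of_dist_stereoInv ((bhDist_nonneg A B).trans h.le) hη hδη hxR hxy.le⟩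

/-- For linear subspaces, closeness in the unit ball scales to all of space. -/
theorem exists_norm_sub_le_of_bhDist_submodule {δ η : ℝ} (hη : η ≤ 1) (hδη : δ * 3 ≤ η)
    (h : bhDist (L : Set (E n)) L' < δ) : ∀ x ∈ L, ∃ y ∈ L', ‖x - y‖ ≤ η * ‖x‖ := by
  intro x hx
  rcases eq_or_ne x 0 with rfl | hx0
  · exact ⟨0, L'.zero_mem, by simp⟩
  have hn : ‖x‖ ≠ 0 := norm_ne_zero_iff.2 hx0
  obtain ⟨y, hy, hxy⟩ := exists_norm_sub_le_of_bhDist (R := 1) ⟨0, L.zero_mem⟩ ⟨0, L'.zero_mem⟩ hη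
    (by linarith) h (‖x‖⁻¹ • x) (L.smul_mem _ hx)
    (by rw [norm_smul, norm_inv, norm_norm, inv_mul_cancel₀ hn])
  refine ⟨‖x‖ • y, L'.smul_mem _ hy, ?_⟩
  have : x - ‖x‖ • y = ‖x‖ • (‖x‖⁻¹ • x - y) := by
    rw [smul_sub, smul_smul, mul_inv_cancel₀ hn, one_smul]
  rw [this, norm_smul, norm_norm, mul_comm]
  exact mul_le_mul_of_nonneg_right hxy (norm_nonneg x)

/-- Sets are close as soon as their points can be matched up to an error which grows at most
linearly with the norm. -/
theorem bhDist_le_of_forall {A B : Set (E n)} {ε : ℝ} (hε : 0 ≤ ε)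
    (h1 : ∀ x ∈ A, ∃ y ∈ B, ‖x - y‖ ≤ ε * (1 + ‖x‖))
    (h2 : ∀ x ∈ B, ∃ y ∈ A, ‖x - y‖ ≤ ε * (1 + ‖x‖)) : bhDist A B ≤ 3 * ε := by
  refine hausdorffDist_le_of_mem_dist (by positivity) ?_ ?_
  · rintro _ ⟨x, hx, rfl⟩
    obtain ⟨y, hy, hxy⟩ := h1 x hx
    exact ⟨_, mem_image_of_mem _ hy, dist_stereoInv_le hε hxy⟩
  · rintro _ ⟨x, hx, rfl⟩
    obtain ⟨y, hy, hxy⟩ := h2 x hx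
    exact ⟨_, mem_image_of_mem _ hy, dist_stereoInv_le hε hxy⟩

/-! ### Continuity of the deformation -/

/-- If `K'` is close to `K` and `L'` is close to `L`, then the cross-section of `K'` is bounded in
terms of that of `K`: it is connected, and it cannot cross the sphere of radius `R + 2`, which stays
away from the cross-section of `K`. -/
theorem norm_starProjection_le_of_close {R η : ℝ} (h' : IsCylinderOver K' L')
    (hc' : Convex ℝ K') (h : IsCylinderOver K L) (hne : K.Nonempty)
    (hR : ∀ x ∈ K, ‖Lᗮ.starProjection x‖ ≤ R) (hη : η * (R + 5) ≤ 1) (hη0 : 0 < η)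
    (h1 : ∀ x ∈ K, ‖x‖ ≤ R + 2 → ∃ y ∈ K', ‖x - y‖ ≤ η)
    (h2 : ∀ x ∈ K', ‖x‖ ≤ R + 2 → ∃ y ∈ K, ‖x - y‖ ≤ η)
    (h3 : ∀ x ∈ L, ∃ y ∈ L', ‖x - y‖ ≤ η * ‖x‖) :
    ∀ x ∈ K', ‖L'ᗮ.starProjection x‖ ≤ R + 2 := by
  intro x hx
  by_contra! hlt
  obtain ⟨p, hp⟩ := hne
  have hR0 : 0 ≤ R := (norm_nonneg _).trans (hR p hp)
  obtain ⟨p', hp', hpp'⟩ := h1 _ (h.starProjection_orthogonal_mem hp) (by linarith [hR p hp])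
  set q := L'ᗮ.starProjection p' with hq
  have hqn : ‖q‖ ≤ R + 2 := by
    have := Submodule.norm_starProjection_apply_le L'ᗮ p'
    have h4 := norm_sub_norm_le p' (Lᗮ.starProjection p)
    rw [norm_sub_rev] at h4
    nlinarith [hR p hp]
  set z := L'ᗮ.starProjection x with hz
  -- A point `y'` of the cross-section of `K'` at distance exactly `R + 2` from the origin.
  obtain ⟨s, hs, hsn⟩ := intermediate_value_Icc (zero_le_one' ℝ)
    (f := fun s : ℝ => ‖(1 - s) • q + s • z‖) (by fun_prop)
    (show R + 2 ∈ _ from ⟨by simpa using hqn, by simpa using hlt.le⟩)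
  set y' := (1 - s) • q + s • z with hy'
  have hy'K : y' ∈ K' := hc' (h'.starProjection_orthogonal_mem hp')
    (h'.starProjection_orthogonal_mem hx) (sub_nonneg.2 hs.2) hs.1 (by ring)
  have hy'L : y' ∈ L'ᗮ := L'ᗮ.add_mem (L'ᗮ.smul_mem _ (Submodule.starProjection_apply_mem _ _))
    (L'ᗮ.smul_mem _ (Submodule.starProjection_apply_mem _ _))
  have hsn' : ‖y'‖ = R + 2 := hsn
  obtain ⟨y, hy, hyy'⟩ := h2 y' hy'K hsn'.le
  -- The component of `y'` along `L` is small, since `y'` is orthogonal to `L'`.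
  set l := L.starProjection y' with hl
  have hlL : l ∈ L := Submodule.starProjection_apply_mem _ _
  obtain ⟨l', hl', hll'⟩ := h3 l hlL
  have hln : ‖l‖ ≤ η * (R + 2) := by
    have e1 : inner ℝ l y' = ‖l‖ ^ 2 := by
      rw [← real_inner_self_eq_norm_sq l]
      have := L.starProjection_inner_eq_zero y' l hlL
      rw [inner_sub_left, sub_eq_zero] at this
      rw [real_inner_comm]
      exact this
    have e2 : inner ℝ l' y' = 0 := hy'L l' hl'
    have e3 : ‖l‖ ^ 2 ≤ η * ‖l‖ * (R + 2) := by
      calc ‖l‖ ^ 2 = inner ℝ (l - l') y' := by rw [inner_sub_left, e1, e2, sub_zero]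
        _ ≤ ‖l - l'‖ * ‖y'‖ := real_inner_le_norm _ _
        _ ≤ η * ‖l‖ * (R + 2) := by rw [hsn']; gcongr
    rcases (norm_nonneg l).eq_or_lt with h0 | h0
    · rw [← h0]; positivity
    · refine le_of_mul_le_mul_right ?_ h0
      linarith [sq ‖l‖]
  have hfin : ‖y'‖ ≤ η * (R + 2) + (R + η) := by
    have e1 : y' = l + (Lᗮ.starProjection y + Lᗮ.starProjection (y' - y)) := by
      rw [map_sub, add_sub_cancel, hl, L.starProjection_add_starProjection_orthogonal]
    rw [e1]
    refine (norm_add_le _ _).trans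
      (add_le_add hln ((norm_add_le _ _).trans (add_le_add (hR y hy) ?_)))
    exact (Submodule.norm_starProjection_apply_le _ _).trans hyy'
  rw [hsn'] at hfin
  nlinarith

/-- The deformed set depends continuously on `K` and `t`, in the sense that points are displaced
by a small amount relative to their norm. -/
theorem exists_mem_flow_close {K K' : ClosedConvexSet n} (h : IsCylinderOver K.carrier L)
    (h' : IsCylinderOver K'.carrier L') {R η : ℝ}
    (hR : ∀ x ∈ K.carrier, ‖Lᗮ.starProjection x‖ ≤ R)
    (h1 : ∀ x ∈ K.carrier, ‖x‖ ≤ R → ∃ y ∈ K'.carrier, ‖x - y‖ ≤ η)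
    (h3 : ∀ x ∈ L, ∃ y ∈ L', ‖x - y‖ ≤ η * ‖x‖) {t t' : I} (ht : |(t : ℝ) - t'| ≤ η) :
    ∀ x ∈ (flow K t).carrier, ∃ y ∈ (flow K' t').carrier,
      ‖x - y‖ ≤ η * (R + 3) * (1 + ‖x‖) := by
  intro x hx
  have hη0 : 0 ≤ η := (abs_nonneg _).trans ht
  obtain ⟨a, ha, haL, b, hbL, hb, hxe⟩ := exists_of_mem_flow h hx
  have haR : ‖a‖ ≤ R := haL ▸ hR a ha
  have hR0 : 0 ≤ R := (norm_nonneg a).trans haR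
  set l := L.starProjection x with hl
  have hlx : ‖l‖ ≤ ‖x‖ := Submodule.norm_starProjection_apply_le _ _
  obtain ⟨a', ha', haa'⟩ := h1 a ha haR
  obtain ⟨l', hl', hll'⟩ := h3 l (Submodule.starProjection_apply_mem _ _)
  refine ⟨(1 - (t' : ℝ)) • a' + l' + (t' : ℝ) • b, (mem_flow_iff h' t' _).2
    ⟨a', ha', l', hl', b, hb, rfl⟩, ?_⟩
  have e : x - ((1 - (t' : ℝ)) • a' + l' + (t' : ℝ) • b) =
      (1 - (t' : ℝ)) • (a - a') + ((t : ℝ) - t') • (b - a) + (l - l') := by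
    conv_lhs => rw [hxe]
    simp only [sub_smul, smul_sub, one_smul]
    abel
  rw [e]
  have n1 : ‖(1 - (t' : ℝ)) • (a - a')‖ ≤ η := by
    rw [norm_smul, Real.norm_of_nonneg (sub_nonneg.2 t'.2.2)]
    exact (mul_le_of_le_one_left (norm_nonneg _) (by linarith [t'.2.1])).trans haa'
  have n2 : ‖((t : ℝ) - t') • (b - a)‖ ≤ η * (1 + R) := by
    rw [norm_smul]
    exact mul_le_mul ht ((norm_sub_le _ _).trans (add_le_add hb haR)) (norm_nonneg _) hη0
  have n3 : ‖l - l'‖ ≤ η * ‖x‖ := hll'.trans (mul_le_mul_of_nonneg_left hlx hη0)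
  have n4 := norm_add₃_le (a := (1 - (t' : ℝ)) • (a - a')) (b := ((t : ℝ) - t') • (b - a))
    (c := l - l')
  have n5 : 0 ≤ η * ‖x‖ * (R + 2) := by positivity
  nlinarith [norm_nonneg x]

theorem continuous_flow {S : Set (ClosedConvexSet n)}
    (hS : ∀ K ∈ S, ∃ L : Submodule ℝ (E n), IsCylinderOver K.carrier L) :
    Continuous fun p : S × I => flow p.1.1 p.2 := by
  rw [Metric.continuous_iff]
  rintro ⟨⟨K, hKS⟩, t⟩ ε hε
  obtain ⟨L, h⟩ := hS K hKS
  obtain ⟨R, hR⟩ := h.bounded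
  have hR0 : 0 ≤ R := (norm_nonneg _).trans (hR _ K.nonempty.some_mem)
  -- `3 η (R + 5) < ε / 2` bounds the displacement of the bodies, and `δ ≤ ε / 2` that of the
  -- recession cones, which do not change in time.
  set η := min 1 (ε / 8) / (R + 5) with hη
  have hR5 : 0 < R + 5 := by linarith
  have hη0 : 0 < η := div_pos (lt_min one_pos (by positivity)) hR5
  have hη5 : η * (R + 5) = min 1 (ε / 8) := div_mul_cancel₀ _ hR5.ne'
  have hη51 : η * (R + 5) ≤ 1 := hη5.trans_le (min_le_left _ _)
  have hη5ε : η * (R + 5) ≤ ε / 8 := hη5.trans_le (min_le_right _ _)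
  have hη1 : η ≤ 1 := by nlinarith
  set D := 3 + 2 * (R + 2) ^ 2 with hD
  have hD3 : 3 ≤ D := by rw [hD]; nlinarith [sq_nonneg (R + 2)]
  set δ := min (η / D) (ε / 2) with hδ
  have hδ0 : 0 < δ := lt_min (by positivity) (by positivity)
  have hδD : δ * D ≤ η := by
    refine (mul_le_mul_of_nonneg_right (min_le_left _ _) (by positivity)).trans_eq ?_
    exact div_mul_cancel₀ _ (by positivity)
  have hδ3 : δ * 3 ≤ η := (mul_le_mul_of_nonneg_left hD3 hδ0.le).trans hδD
  have hδR : δ * (1 + 2 * (R + 2) ^ 2) ≤ η :=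
    (mul_le_mul_of_nonneg_left (by rw [hD]; linarith) hδ0.le).trans hδD
  refine ⟨δ, hδ0, ?_⟩
  rintro ⟨⟨K', hKS'⟩, t'⟩ hdist
  obtain ⟨L', h'⟩ := hS K' hKS'
  rw [dist_comm, Prod.dist_eq, max_lt_iff] at hdist
  obtain ⟨hdK, hdt⟩ := hdist
  have hdK' : bhDist K.carrier K'.carrier +
    bhDist (recessionCone K.carrier) (recessionCone K'.carrier) < δ := hdK
  rw [h.recessionCone_eq K.nonempty, h'.recessionCone_eq K'.nonempty] at hdK'
  have hdL : bhDist (L : Set (E n)) L' < δ := by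
    linarith [bhDist_nonneg K.carrier K'.carrier]
  have hdC : bhDist K.carrier K'.carrier < δ := by
    linarith [bhDist_nonneg (L : Set (E n)) L']
  have hcomm : ∀ A B : Set (E n), bhDist A B = bhDist B A := fun A B => hausdorffDist_comm
  have ht : |(t : ℝ) - t'| ≤ η := by
    have : dist (t : ℝ) t' < δ := hdt
    rw [Real.dist_eq] at this
    linarith
  have c1 := exists_norm_sub_le_of_bhDist K.nonempty K'.nonempty hη1 hδR hdC
  have c2 := exists_norm_sub_le_of_bhDist K'.nonempty K.nonempty hη1 hδR (by rwa [hcomm])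
  have c3 := exists_norm_sub_le_of_bhDist_submodule hη1 hδ3 hdL
  have c4 := exists_norm_sub_le_of_bhDist_submodule hη1 hδ3 (by rwa [hcomm] at hdL)
  have hR' := norm_starProjection_le_of_close h' K'.convex h K.nonempty hR hη51 hη0 c1 c2 c3
  have f1 := exists_mem_flow_close h h' (fun x hx => (hR x hx).trans (by linarith)) c1 c3 ht
  have f2 := exists_mem_flow_close h' h hR' c2 c4 (by rwa [abs_sub_comm] : |(t' : ℝ) - t| ≤ η)
  have e5 : η * (R + 2 + 3) = η * (R + 5) := by ring
  rw [e5] at f1 f2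
  have hb := bhDist_le_of_forall (by positivity) f1 f2
  rw [dist_comm]
  have hfin : bhDist (flow K t).carrier (flow K' t').carrier +
      bhDist (recessionCone (flow K t).carrier) (recessionCone (flow K' t').carrier) < ε := by
    rw [(h.flow t).recessionCone_eq (flow K t).nonempty,
      (h'.flow t').recessionCone_eq (flow K' t').nonempty]
    have : δ ≤ ε / 2 := min_le_right _ _
    linarith
  exact hfin

end Deformation

section Cylinders

open Metric Set

variable {n m : ℕ}

/-! ### Round cylinders -/

/-- The norm of an orthogonal projection in terms of an orthonormal basis of the subspace. -/
theorem norm_starProjection_sq_eq_sum {ι : Type*} [Fintype ι] {u : ι → E n} (hu : Orthonormal ℝ u)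
    {M : Submodule ℝ (E n)} (hM : Submodule.span ℝ (range u) = M) (x : E n) :
    ‖M.starProjection x‖ ^ 2 = ∑ i, inner ℝ (u i) x ^ 2 := by
  have hp : ∑ i, inner ℝ (u i) x • u i = M.starProjection x := by
    refine (Submodule.eq_starProjection_of_mem_orthogonal ?_ ?_).symm
    · exact M.sum_mem fun i _ => M.smul_mem _ (hM ▸ Submodule.subset_span (mem_range_self i))
    · rw [Submodule.mem_orthogonal]
      intro y hy
      rw [← hM] at hy
      induction hy using Submodule.span_induction with
      | mem y hy =>
        obtain ⟨i, rfl⟩ := hy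
        rw [inner_sub_right, hu.inner_right_fintype, sub_self]
      | zero => simp
      | add y z _ _ hy hz => rw [inner_add_left, hy, hz, add_zero]
      | smul c y _ hy => rw [inner_smul_left, hy, mul_zero]
  have h1 : ‖M.starProjection x‖ ^ 2 = inner ℝ (M.starProjection x) x := by
    have := M.starProjection_inner_eq_zero x _ (M.starProjection_apply_mem x)
    rw [inner_sub_left, sub_eq_zero] at this
    rw [← real_inner_self_eq_norm_sq, real_inner_comm, ← this, real_inner_comm]
  rw [h1, ← hp, sum_inner]
  refine Finset.sum_congr rfl fun i _ => ?_
  rw [real_inner_smul_left, sq]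

theorem transpose_mul_self_of_mem (A : Matrix.specialOrthogonalGroup (Fin n) ℝ) :
    A.1.transpose * A.1 = 1 :=
  (Matrix.mem_orthogonalGroup_iff' (Fin n) ℝ).1 (Matrix.mem_specialOrthogonalGroup_iff.1 A.2).1

theorem mem_rotate_iff (A : Matrix.specialOrthogonalGroup (Fin n) ℝ) (K : ClosedConvexSet n)
    (x : E n) :
    x ∈ (rotate A K).carrier ↔ Matrix.toEuclideanLin A.1.transpose x ∈ K.carrier := by
  have hA := transpose_mul_self_of_mem A
  have hA' : A.1 * A.1.transpose = 1 := mul_eq_one_comm.1 hA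
  constructor
  · rintro ⟨y, hy, rfl⟩
    convert! hy
    ext i
    simp [Matrix.toLpLin_apply, Matrix.mulVec_mulVec, hA]
  · intro hx
    refine ⟨_, hx, ?_⟩
    ext i
    simp [Matrix.toLpLin_apply, Matrix.mulVec_mulVec, hA']

/-- The columns of a matrix, as vectors of Euclidean space. -/
def column (A : Matrix (Fin n) (Fin n) ℝ) (i : Fin n) : E n := WithLp.toLp 2 fun j => A j i

theorem toEuclideanLin_transpose_apply (A : Matrix (Fin n) (Fin n) ℝ) (x : E n) (i : Fin n) :
    Matrix.toEuclideanLin A.transpose x i = inner ℝ (column A i) x := by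
  rw [PiLp.inner_apply]
  simp [column, Matrix.toLpLin_apply, Matrix.mulVec, dotProduct, mul_comm]

theorem mem_rotate_stdCylinder_iff (A : Matrix.specialOrthogonalGroup (Fin n) ℝ) (x : E n) :
    x ∈ (rotate A (stdCylinder n m)).carrier ↔
      ∑ i : {i : Fin n // i.val < n - m}, inner ℝ (column A.1 i) x ^ 2 ≤ 1 := by
  rw [mem_rotate_iff]
  change ∑ i : Fin n with i.val < n - m, (Matrix.toEuclideanLin A.1.transpose x) i ^ 2 ≤ 1 ↔ _
  rw [Finset.sum_subtype (p := fun i : Fin n => i.val < n - m) (F := inferInstance)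
    (Finset.univ.filter fun i : Fin n => i.val < n - m) (fun i => by simp)
    (fun i => (Matrix.toEuclideanLin A.1.transpose x) i ^ 2)]
  simp only [toEuclideanLin_transpose_apply]

theorem orthonormal_column {A : Matrix (Fin n) (Fin n) ℝ} (hA : A.transpose * A = 1) :
    Orthonormal ℝ (column A) := by
  rw [orthonormal_iff_ite]
  intro i j
  have := congrFun (congrFun hA i) j
  rw [Matrix.mul_apply, Matrix.one_apply] at this
  rw [← this, PiLp.inner_apply]
  simp [column, mul_comm]

theorem card_lt_sub : Fintype.card {i : Fin n // i.val < n - m} = n - m := by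
  rw [Fintype.card_subtype]
  have : (Finset.univ.filter fun i : Fin n => i.val < n - m) =
      (Finset.univ : Finset (Fin (n - m))).map (Fin.castLEEmb (Nat.sub_le n m)) := by
    ext i
    simp only [Finset.mem_filter, Finset.mem_univ, true_and, Finset.mem_map]
    exact ⟨fun h => ⟨⟨i, h⟩, rfl⟩, by rintro ⟨j, rfl⟩; exact j.2⟩
  rw [this, Finset.card_map, Finset.card_univ, Fintype.card_fin]

/-- An orthonormal family indexed by some of the coordinates consists, up to signs, of columns of a
rotation. -/
theorem exists_specialOrthogonal_column {s : Set (Fin n)} {u : s → E n} (hu : Orthonormal ℝ u) :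
    ∃ A : Matrix.specialOrthogonalGroup (Fin n) ℝ, ∀ (i : s) (x : E n),
      inner ℝ (column A.1 i) x ^ 2 = inner ℝ (u i) x ^ 2 := by
  classical
  let v : Fin n → E n := fun i => if h : i ∈ s then u ⟨i, h⟩ else 0
  have hv : Orthonormal ℝ (s.domRestrict v) := by
    convert! hu with i
    simp [v]
  obtain ⟨b, hb⟩ := hv.exists_orthonormalBasis_extension_of_card_eq (by simp)
  let B : Matrix (Fin n) (Fin n) ℝ := Matrix.of fun j i => b i j
  have hBcol : ∀ i, column B i = b i := fun i => by ext j; simp [column, B]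
  have hB : B.transpose * B = 1 := by
    ext i j
    have := (orthonormal_iff_ite.1 b.orthonormal) i j
    rw [Matrix.mul_apply, Matrix.one_apply, ← this, PiLp.inner_apply]
    simp [B, mul_comm]
  have hdet : B.det * B.det = 1 := by
    have := congrArg Matrix.det hB
    rwa [Matrix.det_mul, Matrix.det_transpose, Matrix.det_one] at this
  rcases Nat.eq_zero_or_pos n with rfl | hn
  · exact ⟨1, fun i => i.1.elim0⟩
  -- Multiplying one column by the determinant turns `B` into a rotation.
  let d : Fin n → ℝ := Function.update 1 ⟨0, hn⟩ B.det
  have hd : ∀ i, d i * d i = 1 := by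
    intro i
    by_cases hi : i = ⟨0, hn⟩
    · subst hi; simpa [d] using hdet
    · simp [d, hi]
  have hA : (B * Matrix.diagonal d) ∈ Matrix.specialOrthogonalGroup (Fin n) ℝ := by
    rw [Matrix.mem_specialOrthogonalGroup_iff, Matrix.mem_orthogonalGroup_iff']
    constructor
    · rw [Matrix.transpose_mul, Matrix.diagonal_transpose, Matrix.mul_assoc,
        ← Matrix.mul_assoc B.transpose, hB, Matrix.one_mul, Matrix.diagonal_mul_diagonal]
      simp [hd]
    · rw [Matrix.det_mul, Matrix.det_diagonal, Finset.prod_update_of_mem (Finset.mem_univ _)]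
      simpa using hdet
  refine ⟨⟨_, hA⟩, fun i x => ?_⟩
  have hcol : column (B * Matrix.diagonal d) i = d i • b i := by
    ext j
    simp [column, B, Matrix.mul_diagonal, mul_comm]
  have hbi : b i = u i := by
    rw [hb i i.2]; simp [v]
  rw [hcol, real_inner_smul_left, mul_pow, sq (d i), hd, one_mul, hbi]

/-- The members of `ℬⁿᵐ` are the unit neighbourhoods of the `m`-dimensional linear subspaces. -/
theorem mem_cylinders_iff (hmn : m < n) (K : ClosedConvexSet n) :
    K ∈ cylinders n m ↔ ∃ L : Submodule ℝ (E n), Module.finrank ℝ L = m ∧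
      ∀ x, x ∈ K.carrier ↔ ‖Lᗮ.starProjection x‖ ≤ 1 := by
  constructor
  · rintro ⟨A, rfl⟩
    let u : {i : Fin n // i.val < n - m} → E n := fun i => column A.1 i
    have hu : Orthonormal ℝ u :=
      (orthonormal_column (transpose_mul_self_of_mem A)).comp _ Subtype.val_injective
    refine ⟨(Submodule.span ℝ (range u))ᗮ, ?_, fun x => ?_⟩
    · rw [finrank_orthogonal, finrank_span_eq_card hu.linearIndependent, card_lt_sub]
      omega
    · rw [mem_rotate_stdCylinder_iff, ← sq_le_one_iff₀ (norm_nonneg _),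
        norm_starProjection_sq_eq_sum hu (Submodule.orthogonal_orthogonal _).symm]
  · rintro ⟨L, hL, hK⟩
    have hcard : Fintype.card {i : Fin n // i.val < n - m} = Module.finrank ℝ Lᗮ := by
      rw [card_lt_sub, finrank_orthogonal, hL]
    let b := (stdOrthonormalBasis ℝ Lᗮ).reindex (Fintype.equivFinOfCardEq hcard).symm
    let u : {i : Fin n // i.val < n - m} → E n := fun i => (b i : E n)
    have hu : Orthonormal ℝ u := b.orthonormal.comp_linearIsometry Lᗮ.subtypeₗᵢ
    have hspan : Submodule.span ℝ (range u) = Lᗮ := by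
      have h1 : range u = Lᗮ.subtype '' range b := by rw [← range_comp]; rfl
      have h2 : Submodule.span ℝ (range b) = ⊤ := by
        rw [← b.coe_toBasis]; exact b.toBasis.span_eq
      rw [h1, Submodule.span_image, h2, Submodule.map_subtype_top]
    obtain ⟨A, hA⟩ := exists_specialOrthogonal_column (s := {i : Fin n | i.val < n - m}) hu
    refine ⟨A, ?_⟩
    ext x
    rw [hK, ← sq_le_one_iff₀ (norm_nonneg _), norm_starProjection_sq_eq_sum hu hspan]
    refine (mem_rotate_stdCylinder_iff A x).trans ?_
    rw [show ∑ i : {i : Fin n // i.val < n - m}, inner ℝ (column A.1 i) x ^ 2 =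
      ∑ i, inner ℝ (u i) x ^ 2 from Finset.sum_congr rfl fun i _ => hA i x]

theorem cylinders_subset_bodies (hm : 1 ≤ m) (hmn : m < n) : cylinders n m ⊆ bodies n m := by
  intro K hK
  obtain ⟨L, hL, h⟩ := (mem_cylinders_iff hmn K).1 hK
  refine mem_bodies_of_isCylinderOver hm hmn ⟨0, ?_⟩ (isCylinderOver_of_forall_iff h) hL
  rw [mem_interior_iff_mem_nhds]
  filter_upwards [closedBall_mem_nhds (0 : E n) one_pos] with x hx
  rw [h]
  exact (Submodule.norm_starProjection_apply_le _ _).trans (mem_closedBall_zero_iff.1 hx)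

end Cylinders

section Nearest

open Metric Set Filter

/-! ### The nearest-point projection and the squared distance to a convex set -/

variable {V : Type*} [NormedAddCommGroup V] [InnerProductSpace ℝ V] {A : Set V} {P : V → V}

/-- `P` is the nearest-point projection onto the closed convex set `A`, in terms of the obtuse
angle criterion. -/
structure IsNearestPoint (A : Set V) (P : V → V) : Prop where
  mem : ∀ x, P x ∈ A
  inner_le : ∀ x, ∀ y ∈ A, inner ℝ (x - P x) (y - P x) ≤ 0

theorem exists_isNearestPoint [CompleteSpace V] (hA : IsClosed A) (hc : Convex ℝ A)
    (hne : A.Nonempty) : ∃ P, IsNearestPoint A P := by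
  choose P hP hP' using fun x => exists_norm_eq_iInf_of_complete_convex hne hA.isComplete hc x
  exact ⟨P, hP, fun x => (norm_eq_iInf_iff_real_inner_le_zero hc (hP x)).1 (hP' x)⟩

namespace IsNearestPoint

/-- The nearest-point projection is firmly nonexpansive. -/
theorem norm_sq_le_inner (h : IsNearestPoint A P) (x y : V) :
    ‖P x - P y‖ ^ 2 ≤ inner ℝ (P x - P y) (x - y) := by
  have h1 := h.inner_le x _ (h.mem y)
  have h2 := h.inner_le y _ (h.mem x)
  rw [← real_inner_self_eq_norm_sq]
  simp only [inner_sub_left, inner_sub_right] at h1 h2 ⊢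
  have e1 := real_inner_comm (P x) (P y)
  have e2 := real_inner_comm (P x) x
  have e3 := real_inner_comm (P y) x
  have e4 := real_inner_comm (P x) y
  have e5 := real_inner_comm (P y) y
  linarith

theorem norm_sub_le (h : IsNearestPoint A P) (x y : V) : ‖P x - P y‖ ≤ ‖x - y‖ := by
  have h1 := (h.norm_sq_le_inner x y).trans (real_inner_le_norm _ _)
  rcases (norm_nonneg (P x - P y)).eq_or_lt with h0 | h0
  · rw [← h0]; exact norm_nonneg _
  · rw [sq] at h1
    exact le_of_mul_le_mul_left h1 h0

theorem continuous (h : IsNearestPoint A P) : Continuous P :=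
  (LipschitzWith.of_dist_le_mul (K := 1) fun x y => by
    simpa [dist_eq_norm] using h.norm_sub_le x y).continuous

theorem norm_le (h : IsNearestPoint A P) (x : V) {y : V} (hy : y ∈ A) : ‖x - P x‖ ≤ ‖x - y‖ := by
  have h1 := h.inner_le x y hy
  have h2 : inner ℝ (x - P x) (x - y) = ‖x - P x‖ ^ 2 - inner ℝ (x - P x) (y - P x) := by
    rw [← real_inner_self_eq_norm_sq, ← inner_sub_right, sub_sub_sub_cancel_right]
  have h3 := real_inner_le_norm (x - P x) (x - y)
  rcases (norm_nonneg (x - P x)).eq_or_lt with h0 | h0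
  · rw [← h0]; exact norm_nonneg _
  · refine le_of_mul_le_mul_left ?_ h0
    rw [← sq]
    linarith

theorem infDist_eq (h : IsNearestPoint A P) (x : V) : infDist x A = ‖x - P x‖ := by
  refine le_antisymm ((infDist_le_dist_of_mem (h.mem x)).trans_eq (dist_eq_norm _ _)) ?_
  refine (le_infDist ⟨_, h.mem x⟩).2 fun y hy => ?_
  rw [dist_eq_norm]
  exact h.norm_le x hy

theorem eq_of_inner_le (h : IsNearestPoint A P) {x p : V} (hp : p ∈ A)
    (hp' : ∀ y ∈ A, inner ℝ (x - p) (y - p) ≤ 0) : P x = p := by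
  have h1 := h.inner_le x p hp
  have h2 := hp' _ (h.mem x)
  have h3 : ‖P x - p‖ ^ 2 ≤ 0 := by
    rw [← real_inner_self_eq_norm_sq]
    simp only [inner_sub_left, inner_sub_right] at h1 h2 ⊢
    linarith [real_inner_comm (P x) p]
  exact sub_eq_zero.1 (norm_eq_zero.1 (pow_eq_zero_iff two_ne_zero |>.1
    (le_antisymm h3 (sq_nonneg _))))

theorem apply_eq_self (h : IsNearestPoint A P) {x : V} (hx : x ∈ A) : P x = x :=
  h.eq_of_inner_le hx fun y _ => by simp

/-- The points of the ray from `P x` through `x` beyond `x` have the same nearest point as `x`. -/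
theorem apply_ray (h : IsNearestPoint A P) (x : V) {s : ℝ} (hs : 0 ≤ s) :
    P (x + s • (x - P x)) = P x := by
  refine h.eq_of_inner_le (h.mem x) fun y hy => ?_
  have : x + s • (x - P x) - P x = (1 + s) • (x - P x) := by rw [add_smul, one_smul]; abel
  rw [this, real_inner_smul_left]
  exact mul_nonpos_of_nonneg_of_nonpos (by linarith) (h.inner_le x y hy)

/-- The squared distance to a convex set is differentiable everywhere. -/
theorem hasFDerivAt_norm_sq (h : IsNearestPoint A P) (x : V) :
    HasFDerivAt (fun y => ‖y - P y‖ ^ 2) ((2 : ℝ) • innerSL ℝ (x - P x)) x := by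
  have upper : ∀ x y : V, ‖y - P y‖ ^ 2 - ‖x - P x‖ ^ 2 - 2 * inner ℝ (x - P x) (y - x) ≤
      ‖y - x‖ ^ 2 := by
    intro x y
    have h1 : ‖y - P y‖ ^ 2 ≤ ‖y - P x‖ ^ 2 :=
      pow_le_pow_left₀ (norm_nonneg _) (h.norm_le y (h.mem x)) 2
    have h2 : ‖y - P x‖ ^ 2 =
        ‖x - P x‖ ^ 2 + 2 * inner ℝ (x - P x) (y - x) + ‖y - x‖ ^ 2 := by
      rw [← norm_add_sq_real]; congr 2; abel
    linarith
  rw [hasFDerivAt_iff_isLittleO]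
  refine Asymptotics.IsBigO.trans_isLittleO (g := fun y => ‖y - x‖ ^ 2) ?_ ?_
  · refine Asymptotics.IsBigO.of_bound 1 (Eventually.of_forall fun y => ?_)
    simp only [one_mul, norm_pow, norm_norm]
    rw [Real.norm_eq_abs, abs_le]
    simp only [smul_apply, innerSL_apply_apply, smul_eq_mul]
    refine ⟨?_, upper x y⟩
    have h1 := upper y x
    have h2 : inner ℝ (P y - P x) (y - x) ≤ ‖y - x‖ ^ 2 := by
      refine (real_inner_le_norm _ _).trans ?_
      rw [sq]
      exact mul_le_mul_of_nonneg_right (h.norm_sub_le y x) (norm_nonneg _)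
    have h3 : inner ℝ (y - P y) (x - y) =
        -(inner ℝ (x - P x) (y - x) + ‖y - x‖ ^ 2 - inner ℝ (P y - P x) (y - x)) := by
      rw [← neg_sub y x, inner_neg_right, ← real_inner_self_eq_norm_sq (y - x), ← inner_add_left,
        ← inner_sub_left]
      congr 2; abel
    rw [norm_sub_rev x y, h3] at h1
    linarith
  · have h1 : (fun y : V => ‖y - x‖ ^ 2) = fun y => ‖y - x‖ * ‖y - x‖ := by
      funext y; ring
    rw [h1]
    have h2 : (fun y : V => ‖y - x‖) =o[𝓝 x] fun _ => (1 : ℝ) := by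
      rw [Asymptotics.isLittleO_one_iff]
      have : ContinuousAt (fun y : V => ‖y - x‖) x := by fun_prop
      simpa [ContinuousAt] using this
    refine Asymptotics.IsLittleO.of_norm_right ?_
    simpa using h2.mul_isBigO (Asymptotics.isBigO_refl (fun y : V => ‖y - x‖) (𝓝 x))

/-- If the nearest-point projection is of class `Cʲ`, then the squared distance is of class
`Cʲ⁺¹`. -/
theorem contDiffOn_norm_sq (h : IsNearestPoint A P) {U : Set V} (hU : IsOpen U) {j : WithTop ℕ∞}
    (hP : ContDiffOn ℝ j P U) : ContDiffOn ℝ (j + 1) (fun y => ‖y - P y‖ ^ 2) U := by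
  have hsub : ContDiffOn ℝ j (fun y => y - P y) U := contDiffOn_id.sub hP
  rw [contDiffOn_succ_iff_fderiv_of_isOpen hU]
  refine ⟨fun x _ => (h.hasFDerivAt_norm_sq x).differentiableAt.differentiableWithinAt, ?_, ?_⟩
  · rintro rfl
    exact (hsub.norm_sq ℝ).analyticOn
  · have : fderiv ℝ (fun y => ‖y - P y‖ ^ 2) = fun x => (2 : ℝ) • innerSL ℝ (x - P x) :=
      funext fun x => (h.hasFDerivAt_norm_sq x).fderiv
    rw [this]
    exact ((innerSL ℝ (E := V)).contDiff.comp_contDiffOn hsub).const_smul 2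

end IsNearestPoint

/-- The boundary of the closed `t`-neighbourhood of a convex set consists of the points at
distance `t`. -/
theorem frontier_cthickening_eq (h : IsNearestPoint A P) {t : ℝ} (ht : 0 < t) :
    frontier (cthickening t A) = {x | ‖x - P x‖ = t} := by
  have hne : A.Nonempty := ⟨_, h.mem 0⟩
  have hmem : ∀ x, x ∈ cthickening t A ↔ ‖x - P x‖ ≤ t := by
    intro x
    rw [mem_cthickening_iff, ← h.infDist_eq, infDist,
      ENNReal.le_ofReal_iff_toReal_le (infEDist_ne_top hne) ht.le]
  ext x
  constructor
  · intro hx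
    have h1 := frontier_cthickening_subset A hx
    change infEDist x A = _ at h1
    change ‖x - P x‖ = t
    rw [← h.infDist_eq, infDist, h1, ENNReal.toReal_ofReal ht.le]
  · intro (hx : ‖x - P x‖ = t)
    rw [frontier, isClosed_cthickening.closure_eq]
    refine ⟨(hmem x).2 hx.le, fun hint => ?_⟩
    -- Moving away from the nearest point leaves the neighbourhood.
    have hc : Tendsto (fun s : ℝ => x + s • (x - P x)) (𝓝[>] 0) (𝓝 x) := by
      have : ContinuousAt (fun s : ℝ => x + s • (x - P x)) 0 := by fun_prop
      simpa using this.tendsto.mono_left nhdsWithin_le_nhds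
    obtain ⟨s, hs, hs0⟩ := ((hc.eventually (mem_interior_iff_mem_nhds.1 hint)).and
      self_mem_nhdsWithin).exists
    have hs0' : 0 < s := hs0
    have h2 := (hmem _).1 hs
    rw [h.apply_ray x hs0'.le,
      show x + s • (x - P x) - P x = (1 + s) • (x - P x) by rw [add_smul, one_smul]; abel,
      norm_smul, hx, Real.norm_of_nonneg (by linarith)] at h2
    nlinarith

/-- The boundary of an outer parallel body of `A` is a regular level set of the squared distance
to `A`. -/
theorem isRegularHypersurface_frontier_cthickening {n : ℕ} {A : Set (E n)} {P : E n → E n}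
    (h : IsNearestPoint A P) (hA : IsClosed A) {j : WithTop ℕ∞} (hP : ContDiffOn ℝ j P Aᶜ)
    {t : ℝ} (ht : 0 < t) : IsRegularHypersurface (j + 1) (frontier (cthickening t A)) := by
  rw [frontier_cthickening_eq h ht]
  have hnot : ∀ x, x ∉ A ↔ x - P x ≠ 0 := fun x => not_congr
    ⟨fun hx => by rw [h.apply_eq_self hx, sub_self], fun hx => by
      rw [sub_eq_zero.1 hx]; exact h.mem x⟩
  intro p hp
  refine ⟨Aᶜ, fun x => ‖x - P x‖ ^ 2 - t ^ 2, hA.isOpen_compl, ?_,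
    (h.contDiffOn_norm_sq hA.isOpen_compl hP).sub contDiffOn_const, fun x hx h0 => ?_, ?_⟩
  · rw [mem_compl_iff, hnot, ← norm_ne_zero_iff]
    rw [mem_ofPred_eq] at hp
    rw [hp]; exact ht.ne'
  · have h1 : fderiv ℝ (fun x => ‖x - P x‖ ^ 2 - t ^ 2) x = (2 : ℝ) • innerSL ℝ (x - P x) :=
      ((h.hasFDerivAt_norm_sq x).sub_const _).fderiv
    have h2 := congrArg (fun l => l (x - P x)) (h1.symm.trans h0)
    simp only [smul_apply, innerSL_apply_apply, smul_eq_mul,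
      zero_apply, mul_eq_zero, two_ne_zero, false_or, inner_self_eq_zero] at h2
    exact (hnot x).1 hx h2
  · ext x
    simp only [mem_inter_iff, mem_ofPred_eq, sub_eq_zero]
    rw [sq_eq_sq₀ (norm_nonneg _) ht.le, and_comm]

/-! ### Regularity of the nearest-point projection -/

/-- Second order necessary condition for the linear function `s ⟨g p, ·⟩` to be maximal at `p` on
the level set `{f = 0}`, where `g` is the gradient of `f`. -/
theorem second_order_nonneg [CompleteSpace V] {f : V → ℝ} {g : V → V} {p w : V} {s : ℝ}
    {g' : V →L[ℝ] V}
    (hf : ∀ᶠ y in 𝓝 p, HasFDerivAt f (innerSL ℝ (g y)) y)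
    (hstrict : HasStrictFDerivAt f (innerSL ℝ (g p)) p) (hgp : g p ≠ 0) (hfp : f p = 0)
    (hg : HasFDerivAt g g' p) (hmax : ∀ᶠ y in 𝓝 p, f y = 0 → s * inner ℝ (g p) (y - p) ≤ 0)
    (hw : inner ℝ (g p) w = 0) : 0 ≤ s * inner ℝ (g' w) w := by
  have hrange : (innerSL ℝ (g p)).range = ⊤ := by
    rw [LinearMap.range_eq_top]
    intro c
    refine ⟨(c / inner ℝ (g p) (g p)) • g p, ?_⟩
    have : inner ℝ (g p) (g p) ≠ 0 := inner_self_ne_zero.2 hgp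
    change inner ℝ (g p) _ = c
    rw [real_inner_smul_right, div_mul_cancel₀ _ this]
  -- A curve `γ` in the level set with `γ 0 = p` and `γ' 0 = w`.
  let w' : (innerSL ℝ (g p)).ker := ⟨w, hw⟩
  let Γ := hstrict.implicitFunctionOfComplemented f _ hrange
    (ContinuousLinearMap.ker_closedComplemented_of_finiteDimensional_range _) (f p)
  have hΓ0 : Γ 0 = p := hstrict.implicitFunctionOfComplemented_apply_image hrange _
  have hΓ : HasStrictFDerivAt Γ (innerSL ℝ (g p)).ker.subtypeL 0 :=
    hstrict.to_implicitFunctionOfComplemented hrange _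
  have hΓf : ∀ᶠ v in 𝓝 0, f (Γ v) = f p := by
    have h1 := hstrict.map_implicitFunctionOfComplemented_eq hrange
      (ContinuousLinearMap.ker_closedComplemented_of_finiteDimensional_range _)
    have h2 : Tendsto (fun v : (innerSL ℝ (g p)).ker => (f p, v)) (𝓝 0) (𝓝 (f p, 0)) := by
      have : ContinuousAt (fun v : (innerSL ℝ (g p)).ker => (f p, v)) 0 := by fun_prop
      exact this
    exact h2.eventually h1
  let γ : ℝ → V := fun τ => Γ (τ • w')
  have hz : (0 : ℝ) • w' = 0 := zero_smul ℝ w'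
  have hγ0 : γ 0 = p := (congrArg Γ hz).trans hΓ0
  have hsm : HasDerivAt (fun τ : ℝ => τ • w') w' 0 := by
    have := (hasDerivAt_id (0 : ℝ)).smul_const w'
    rwa [one_smul ℝ w'] at this
  have hγ : HasDerivAt γ w 0 := by
    have h1 : HasFDerivAt Γ (innerSL ℝ (g p)).ker.subtypeL ((0 : ℝ) • w') := by
      rw [zero_smul]; exact hΓ.hasFDerivAt
    exact h1.comp_hasDerivAt (0 : ℝ) hsm
  have hγf : ∀ᶠ τ in 𝓝 0, f (γ τ) = 0 := by
    have h1 : Tendsto (fun τ : ℝ => τ • w') (𝓝 0) (𝓝 0) := by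
      have := hsm.continuousAt.tendsto
      rwa [hz] at this
    filter_upwards [h1.eventually hΓf] with τ hτ
    rw [← hfp]; exact hτ
  have hγp : Tendsto γ (𝓝 0) (𝓝 p) := by simpa [hγ0] using hγ.continuousAt.tendsto
  have hslope : Tendsto (fun τ : ℝ => τ⁻¹ • (γ τ - p)) (𝓝[>] 0) (𝓝 w) := by
    have := hγ.tendsto_slope_zero_right
    simpa [hγ0] using this
  suffices hε : ∀ ε : ℝ, 0 < ε → 0 ≤ s * inner ℝ (g' w) w + |s| * ε * ‖w‖ ^ 2 by
    have hlim : Tendsto (fun ε : ℝ => s * inner ℝ (g' w) w + |s| * ε * ‖w‖ ^ 2) (𝓝[>] 0)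
        (𝓝 (s * inner ℝ (g' w) w)) := by
      have : ContinuousAt (fun ε : ℝ => s * inner ℝ (g' w) w + |s| * ε * ‖w‖ ^ 2) 0 := by fun_prop
      simpa using this.tendsto.mono_left nhdsWithin_le_nhds
    exact ge_of_tendsto hlim (eventually_mem_nhdsWithin.mono fun ε hε' => hε ε hε')
  intro ε hε
  have hcont : Tendsto (fun τ : ℝ => s * inner ℝ (g' (τ⁻¹ • (γ τ - p))) (τ⁻¹ • (γ τ - p)) +
      |s| * ε * ‖τ⁻¹ • (γ τ - p)‖ ^ 2) (𝓝[>] 0)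
      (𝓝 (s * inner ℝ (g' w) w + |s| * ε * ‖w‖ ^ 2)) := by
    have : Continuous fun h : V => s * inner ℝ (g' h) h + |s| * ε * ‖h‖ ^ 2 := by fun_prop
    exact (this.tendsto w).comp hslope
  refine ge_of_tendsto hcont ?_
  have hgε := hg.isLittleO.def hε
  obtain ⟨r, hr, hball⟩ := Metric.eventually_nhds_iff_ball.1 (hf.and hgε)
  have hγr : ∀ᶠ τ in 𝓝[>] (0 : ℝ), γ τ ∈ ball p r :=
    (hγp.eventually (ball_mem_nhds p hr)).filter_mono nhdsWithin_le_nhds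
  filter_upwards [hγr, hγf.filter_mono nhdsWithin_le_nhds,
    (hγp.eventually hmax).filter_mono nhdsWithin_le_nhds, self_mem_nhdsWithin]
    with τ hτr hτf hτmax hτ
  have hτ0 : 0 < τ := hτ
  set d := γ τ - p with hd
  have hle := hτmax hτf
  have hseg : ∀ θ ∈ Icc (0 : ℝ) 1, p + θ • d ∈ ball p r := by
    intro θ hθ
    rw [mem_ball, dist_eq_norm] at hτr ⊢
    rw [add_sub_cancel_left, norm_smul, Real.norm_of_nonneg hθ.1]
    exact (mul_le_of_le_one_left (norm_nonneg _) hθ.2).trans_lt hτr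
  have hder : ∀ θ ∈ Icc (0 : ℝ) 1,
      HasDerivAt (fun θ : ℝ => f (p + θ • d)) (inner ℝ (g (p + θ • d)) d) θ := by
    intro θ hθ
    have h1 : HasDerivAt (fun θ : ℝ => p + θ • d) d θ := by
      simpa using ((hasDerivAt_id θ).smul_const d).const_add p
    exact (hball _ (hseg θ hθ)).1.comp_hasDerivAt θ h1
  obtain ⟨θ, hθ, hθe⟩ := exists_hasDerivAt_eq_slope (fun θ : ℝ => f (p + θ • d)) _ zero_lt_one
    (fun θ hθ => (hder θ hθ).continuousAt.continuousWithinAt)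
    (fun θ hθ => hder θ (Ioo_subset_Icc_self hθ))
  have hpd : p + d = γ τ := by rw [hd]; abel
  simp only [one_smul, zero_smul, add_zero, hpd, hτf, hfp, sub_self, zero_div] at hθe
  have hb := (hball _ (hseg θ (Ioo_subset_Icc_self hθ))).2
  rw [add_sub_cancel_left, map_smul, norm_smul, Real.norm_of_nonneg hθ.1.le] at hb
  have h1 : 0 ≤ s * inner ℝ (g (p + θ • d) - g p) d := by
    rw [inner_sub_left, hθe, zero_sub]
    linarith
  have h2 : s * inner ℝ (g (p + θ • d) - g p) d ≤
      θ * (s * inner ℝ (g' d) d) + |s| * (ε * (θ * ‖d‖)) * ‖d‖ := by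
    have e1 : s * inner ℝ (g (p + θ • d) - g p) d =
        θ * (s * inner ℝ (g' d) d) + s * inner ℝ (g (p + θ • d) - g p - θ • g' d) d := by
      rw [inner_sub_left (g (p + θ • d) - g p), real_inner_smul_left]; ring
    rw [e1]
    refine add_le_add le_rfl ((le_abs_self _).trans ?_)
    rw [abs_mul, mul_assoc]
    refine mul_le_mul_of_nonneg_left ((abs_real_inner_le_norm _ _).trans ?_) (abs_nonneg s)
    exact mul_le_mul_of_nonneg_right hb (norm_nonneg _)
  have h3 : 0 ≤ s * inner ℝ (g' d) d + |s| * ε * ‖d‖ ^ 2 := by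
    refine le_of_mul_le_mul_left (a := θ) ?_ hθ.1
    nlinarith
  rw [map_smul, real_inner_smul_left, real_inner_smul_right, norm_smul, mul_pow,
    Real.norm_of_nonneg (inv_nonneg.2 hτ0.le)]
  have h4 : s * (τ⁻¹ * (τ⁻¹ * inner ℝ (g' d) d)) + |s| * ε * (τ⁻¹ ^ 2 * ‖d‖ ^ 2) =
      τ⁻¹ ^ 2 * (s * inner ℝ (g' d) d + |s| * ε * ‖d‖ ^ 2) := by ring
  rw [h4]
  positivity

/-- Lagrange multipliers: the normal of a convex set at a boundary point is a multiple of the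
gradient of a function defining the boundary. -/
theorem exists_eq_smul_of_inner_le [CompleteSpace V] {f : V → ℝ} {q gq ν : V}
    (hf : HasStrictFDerivAt f (innerSL ℝ gq) q) (hgq : gq ≠ 0)
    (hmax : ∀ᶠ y in 𝓝 q, f y = f q → inner ℝ ν (y - q) ≤ 0) : ∃ c : ℝ, ν = c • gq := by
  have hext : IsLocalExtrOn (innerSL ℝ ν) {x | f x = f q} q := by
    refine Or.inr ?_
    change ∀ᶠ y in 𝓝[{x | f x = f q}] q, innerSL ℝ ν y ≤ innerSL ℝ ν q
    rw [eventually_nhdsWithin_iff]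
    filter_upwards [hmax] with y hy hyq
    have := hy hyq
    rw [inner_sub_right] at this
    simpa using this
  obtain ⟨a, b, hab, h0⟩ := hext.exists_multipliers_of_hasStrictFDerivAt_1d hf
    (innerSL ℝ ν).hasStrictFDerivAt
  have h1 : a • gq + b • ν = 0 := by
    refine ext_inner_right ℝ fun v => ?_
    have := congrArg (fun l => l v) h0
    simpa [inner_add_left, real_inner_smul_left] using this
  have hb : b ≠ 0 := by
    rintro rfl
    rw [zero_smul, add_zero, smul_eq_zero] at h1
    exact hab (by simp [h1.resolve_right hgq])
  refine ⟨-(b⁻¹ * a), ?_⟩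
  have h2 : b • ν = -(a • gq) := by rw [← sub_eq_zero, sub_neg_eq_add, add_comm]; exact h1
  rw [neg_smul, mul_smul, ← smul_neg, ← h2, smul_smul, inv_mul_cancel₀ hb, one_smul]

end Nearest

section Regularity

open Metric Set Filter
open scoped ContDiff

variable {V : Type*} [NormedAddCommGroup V] [InnerProductSpace ℝ V] {A : Set V} {P : V → V}

theorem IsNearestPoint.mem_frontier (h : IsNearestPoint A P) {x : V} (hx : x ∉ A) :
    P x ∈ frontier A := by
  refine ⟨subset_closure (h.mem x), fun hint => ?_⟩
  have hne : x - P x ≠ 0 := fun h0 => hx (by rw [sub_eq_zero.1 h0]; exact h.mem x)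
  have hc : Tendsto (fun s : ℝ => P x + s • (x - P x)) (𝓝[>] 0) (𝓝 (P x)) := by
    have : ContinuousAt (fun s : ℝ => P x + s • (x - P x)) 0 := by fun_prop
    simpa using this.tendsto.mono_left nhdsWithin_le_nhds
  obtain ⟨s, hs, hs0⟩ := ((hc.eventually (mem_interior_iff_mem_nhds.1 hint)).and
    self_mem_nhdsWithin).exists
  have hs0' : 0 < s := hs0
  have h1 := h.inner_le x _ hs
  rw [add_sub_cancel_left, real_inner_smul_right, real_inner_self_eq_norm_sq] at h1
  have h2 : 0 < ‖x - P x‖ := norm_pos_iff.2 hne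
  have : 0 < s * ‖x - P x‖ ^ 2 := by positivity
  linarith

/-- If the boundary of a closed convex set is of class `Cʲ⁺¹`, then the nearest-point projection is
of class `Cʲ` outside of the set. With `f` a defining function of the boundary, `(y, s) = (P x, s)`
solves `y + s ∇f(y) = x`, `f(y) = 0`, and the inverse function theorem applies because convexity
makes `s D²f` nonnegative on tangent vectors. -/
theorem IsNearestPoint.contDiffAt [FiniteDimensional ℝ V] (h : IsNearestPoint A P)
    (hA : IsClosed A) {x₀ : V} (hx₀ : x₀ ∉ A) {U : Set V} (hU : IsOpen U) (hpU : P x₀ ∈ U)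
    {f : V → ℝ} {j : WithTop ℕ∞} (hj : j ≠ 0) (hf : ContDiffOn ℝ (j + 1) f U)
    (hf0 : ∀ x ∈ U, fderiv ℝ f x ≠ 0) (hfA : frontier A ∩ U = {x ∈ U | f x = 0}) :
    ContDiffAt ℝ j P x₀ := by
  have hj1 : j + 1 ≠ 0 := by
    intro h0
    exact hj (by simpa using (add_eq_zero.1 h0).1)
  set p := P x₀ with hp
  set g : V → V := fun y => (InnerProductSpace.toDual ℝ V).symm (fderiv ℝ f y) with hg
  have hgi : ∀ y, innerSL ℝ (g y) = fderiv ℝ f y := fun y => by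
    ext v
    rw [innerSL_apply_apply, hg, InnerProductSpace.toDual_symm_apply]
  have hgC : ContDiffOn ℝ j g U :=
    (InnerProductSpace.toDual ℝ V).symm.contDiff.comp_contDiffOn (hf.fderiv_of_isOpen hU le_rfl)
  have hg0 : ∀ y ∈ U, g y ≠ 0 := fun y hy h0 => hf0 y hy (by rw [← hgi, h0, map_zero])
  have hfd : ∀ y ∈ U, HasStrictFDerivAt f (innerSL ℝ (g y)) y := fun y hy => by
    rw [hgi]
    exact (hf.contDiffAt (hU.mem_nhds hy)).hasStrictFDerivAt hj1
  have hzero : ∀ y ∈ U, f y = 0 → y ∈ A := fun y hy hy0 =>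
    hA.frontier_subset (hfA.symm.subset ⟨hy, hy0⟩ : y ∈ frontier A ∩ U).1
  have hzero' : ∀ y ∈ U, y ∈ frontier A → f y = 0 := fun y hy hyA => (hfA.subset ⟨hyA, hy⟩).2
  have hgp : ContDiffAt ℝ j g p := hgC.contDiffAt (hU.mem_nhds hpU)
  have hfp : ContDiffAt ℝ j f p := (hf.contDiffAt (hU.mem_nhds hpU)).of_le le_self_add
  have hPc := h.continuous
  -- The multiplier `s` with `x = P x + s x • ∇f (P x)`.
  set s : V → ℝ := fun x => inner ℝ (g (P x)) (x - P x) / ‖g (P x)‖ ^ 2 with hs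
  have hnear : ∀ᶠ x in 𝓝 x₀, x ∉ A ∧ P x ∈ U :=
    (hA.isOpen_compl.eventually_mem hx₀).and (hPc.continuousAt.eventually_mem (hU.mem_nhds hpU))
  have hmult : ∀ x, x ∉ A → P x ∈ U → P x + s x • g (P x) = x ∧ f (P x) = 0 := by
    intro x hx hxU
    have h0 := hzero' _ hxU (h.mem_frontier hx)
    obtain ⟨c, hc⟩ := exists_eq_smul_of_inner_le (ν := x - P x) (hfd _ hxU) (hg0 _ hxU) (by
      filter_upwards [hU.mem_nhds hxU] with y hy hyf
      exact h.inner_le x y (hzero y hy (hyf.trans h0)))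
    have hn : ‖g (P x)‖ ^ 2 ≠ 0 := pow_ne_zero 2 (norm_ne_zero_iff.2 (hg0 _ hxU))
    have hsc : s x = c := by
      simp only [hs]
      rw [hc, real_inner_smul_right, real_inner_self_eq_norm_sq, mul_div_cancel_right₀ _ hn]
    refine ⟨?_, h0⟩
    rw [hsc, ← hc, add_sub_cancel]
  obtain ⟨hx₀p, hfp0⟩ := hmult x₀ hx₀ hpU
  set s₀ := s x₀ with hs₀
  have hgPc : ContinuousAt (fun x => g (P x)) x₀ :=
    ContinuousAt.comp (g := g) hgp.continuousAt hPc.continuousAt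
  have hsc : ContinuousAt s x₀ := by
    refine (hgPc.inner (continuousAt_id.sub hPc.continuousAt)).div (hgPc.norm.pow 2) ?_
    exact pow_ne_zero 2 (norm_ne_zero_iff.2 (hg0 _ hpU))
  -- `Φ` is the normal map; `(P x, s x)` is the solution of `Φ u = (x, 0)`.
  set Φ : V × ℝ → V × ℝ := fun u => (u.1 + u.2 • g u.1, f u.1) with hΦ
  have hΦC : ContDiffAt ℝ j Φ (p, s₀) := by
    have h1 : ContDiffAt ℝ j (fun u : V × ℝ => g u.1) (p, s₀) :=
      ContDiffAt.comp (p, s₀) (g := g) hgp contDiffAt_fst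
    have h2 : ContDiffAt ℝ j (fun u : V × ℝ => f u.1) (p, s₀) :=
      ContDiffAt.comp (p, s₀) (g := f) hfp contDiffAt_fst
    exact (contDiffAt_fst.add (contDiffAt_snd.smul h1)).prodMk h2
  set g' := fderiv ℝ g p
  have hg' : HasFDerivAt g g' p := (hgp.differentiableAt hj).hasFDerivAt
  have hpar : x₀ - p = s₀ • g p := by
    rw [sub_eq_iff_eq_add, add_comm]; exact hx₀p.symm
  have hsecond : ∀ w, inner ℝ (g p) w = 0 → 0 ≤ s₀ * inner ℝ (g' w) w := by
    intro w hw
    refine second_order_nonneg ?_ (hfd p hpU) (hg0 p hpU) hfp0 hg' ?_ hw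
    · filter_upwards [hU.mem_nhds hpU] with y hy
      exact (hfd y hy).hasFDerivAt
    · filter_upwards [hU.mem_nhds hpU] with y hy hy0
      rw [← real_inner_smul_left, ← hpar]
      exact h.inner_le x₀ y (hzero y hy hy0)
  let Φ' : V × ℝ →L[ℝ] V × ℝ :=
    (ContinuousLinearMap.fst ℝ V ℝ + (s₀ • g'.comp (ContinuousLinearMap.fst ℝ V ℝ) +
      (ContinuousLinearMap.snd ℝ V ℝ).smulRight (g p))).prod
    ((innerSL ℝ (g p)).comp (ContinuousLinearMap.fst ℝ V ℝ))
  have hΦ' : HasFDerivAt Φ Φ' (p, s₀) := by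
    have h1 : HasFDerivAt (fun u : V × ℝ => g u.1)
        (g'.comp (ContinuousLinearMap.fst ℝ V ℝ)) (p, s₀) :=
      HasFDerivAt.comp (p, s₀) (g := g) hg' hasFDerivAt_fst
    have h2 : HasFDerivAt (fun u : V × ℝ => f u.1)
        ((innerSL ℝ (g p)).comp (ContinuousLinearMap.fst ℝ V ℝ)) (p, s₀) :=
      HasFDerivAt.comp (p, s₀) (g := f) (hfd p hpU).hasFDerivAt hasFDerivAt_fst
    exact (hasFDerivAt_fst.add (hasFDerivAt_snd.smul h1)).prodMk h2
  -- A kernel vector `(w, c)` has `w` tangent to the boundary and `‖w‖² + s₀ ⟨g' w, w⟩ = 0`.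
  have hinj : Function.Injective (Φ' : V × ℝ →ₗ[ℝ] V × ℝ) := by
    rw [← LinearMap.ker_eq_bot, LinearMap.ker_eq_bot']
    rintro ⟨w, c⟩ h0
    have h1 : w + (s₀ • g' w + c • g p) = 0 := congrArg Prod.fst h0
    have h2 : inner ℝ (g p) w = 0 := congrArg Prod.snd h0
    have h3 := congrArg (fun v => inner ℝ v w) h1
    simp only [inner_add_left, real_inner_smul_left, h2, inner_zero_left,
      real_inner_self_eq_norm_sq, mul_zero, add_zero] at h3
    have h4 := hsecond w h2
    have hw : w = 0 := by
      have : ‖w‖ ^ 2 = 0 := le_antisymm (by linarith) (sq_nonneg _)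
      exact norm_eq_zero.1 (pow_eq_zero_iff two_ne_zero |>.1 this)
    subst hw
    rw [map_zero, smul_zero, zero_add, zero_add, smul_eq_zero] at h1
    rw [h1.resolve_right (hg0 p hpU)]
    rfl
  let e : (V × ℝ) ≃L[ℝ] (V × ℝ) :=
    (LinearEquiv.ofInjectiveEndo (Φ' : V × ℝ →ₗ[ℝ] V × ℝ) hinj).toContinuousLinearEquiv
  have he : HasFDerivAt Φ (e : V × ℝ →L[ℝ] V × ℝ) (p, s₀) := hΦ'
  have hloc := hΦC.to_localInverse he hj
  have hleft : ∀ᶠ u in 𝓝 (p, s₀), hΦC.localInverse he hj (Φ u) = u :=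
    (hΦC.hasStrictFDerivAt' he hj).eventually_left_inverse
  have hΦp : Φ (p, s₀) = (x₀, 0) := Prod.ext hx₀p hfp0
  rw [hΦp] at hloc
  have hps : Tendsto (fun x => (P x, s x)) (𝓝 x₀) (𝓝 (p, s₀)) :=
    hPc.continuousAt.prodMk_nhds hsc
  have heq : P =ᶠ[𝓝 x₀] fun x => (hΦC.localInverse he hj (x, 0)).1 := by
    filter_upwards [hnear, hps.eventually hleft] with x hx hxl
    obtain ⟨h1, h2⟩ := hmult x hx.1 hx.2
    have h3 : Φ (P x, s x) = (x, 0) := Prod.ext h1 h2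
    rw [← h3, hxl]
  refine ContDiffAt.congr_of_eventuallyEq ?_ heq
  exact contDiffAt_fst.comp x₀ (hloc.comp x₀ (contDiffAt_id.prodMk contDiffAt_const))

variable {n m : ℕ}

theorem contDiffOn_nearestPoint {A : Set (E n)} {P : E n → E n} (h : IsNearestPoint A P)
    (hA : IsClosed A) {j : WithTop ℕ∞} (hreg : IsRegularHypersurface (j + 1) (frontier A)) :
    ContDiffOn ℝ j P Aᶜ := by
  rcases eq_or_ne j 0 with rfl | hj
  · exact contDiffOn_zero.2 h.continuous.continuousOn
  · intro x hx
    obtain ⟨U, f, hU, hpU, hf, hf0, hfA⟩ := hreg _ (h.mem_frontier hx)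
    exact (h.contDiffAt hA hx hU hpU hj hf hf0 hfA).contDiffWithinAt

/-- Regularity is invariant under homotheties. -/
theorem isRegularHypersurface_preimage_smul {k : WithTop ℕ∞} {M : Set (E n)}
    (h : IsRegularHypersurface k M) (hk : 1 ≤ k) {c : ℝ} (hc : c ≠ 0) :
    IsRegularHypersurface k ((fun x => c • x) ⁻¹' M) := by
  intro p hp
  obtain ⟨U, f, hU, hpU, hf, hf0, hfM⟩ := h _ hp
  have hcont : Continuous fun x : E n => c • x := continuous_const_smul c
  refine ⟨(fun x => c • x) ⁻¹' U, fun x => f (c • x), hU.preimage hcont, hpU,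
    hf.comp (contDiff_const_smul c).contDiffOn fun x hx => hx, fun x hx h0 => hf0 _ hx ?_, ?_⟩
  · have hd : DifferentiableAt ℝ f (c • x) :=
      (hf.contDiffAt (hU.mem_nhds hx)).differentiableAt (by
        rintro rfl; exact absurd hk (by simp))
    have h1 : HasFDerivAt (fun x => f (c • x))
        ((fderiv ℝ f (c • x)).comp (c • ContinuousLinearMap.id ℝ (E n))) x :=
      HasFDerivAt.comp x (g := f) hd.hasFDerivAt ((hasFDerivAt_id x).const_smul c)
    rw [h1.fderiv] at h0
    ext v
    have h2 := congrArg (fun l => l (c⁻¹ • v)) h0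
    simpa [smul_smul, mul_inv_cancel₀ hc, hc] using h2
  · ext x
    exact Set.ext_iff.1 hfM (c • x)

theorem exists_eq_add_one {k : WithTop ℕ∞} (hk : 1 ≤ k) : ∃ j : WithTop ℕ∞, k = j + 1 := by
  obtain ⟨j, hj⟩ := exists_add_of_le hk
  exact ⟨j, hj.trans (add_comm 1 j)⟩

/-- The deformation preserves the regularity of the boundary. -/
theorem isRegularHypersurface_frontier_flow {K : ClosedConvexSet n} {L : Submodule ℝ (E n)}
    (h : IsCylinderOver K.carrier L) {k : WithTop ℕ∞} (hk : 1 ≤ k)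
    (hreg : IsRegularHypersurface k (frontier K.carrier)) (t : I) :
    IsRegularHypersurface k (frontier (flow K t).carrier) := by
  rcases eq_or_ne t 0 with rfl | ht0
  · rwa [flow_zero h]
  have ht : (0 : ℝ) < t := unitInterval.coe_pos.2 (unitInterval.pos_iff_ne_zero.2 ht0)
  obtain ⟨j, rfl⟩ := exists_eq_add_one hk
  have hcl := isClosed_shrink h K.nonempty K.isClosed t.2.2
  suffices hP : ∃ P, IsNearestPoint (shrink K.carrier t) P ∧
      ContDiffOn ℝ j P (shrink K.carrier t)ᶜ by
    obtain ⟨P, hP, hPC⟩ := hP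
    exact isRegularHypersurface_frontier_cthickening hP hcl hPC ht
  rcases t.2.2.eq_or_lt with ht1 | ht1
  · rw [ht1, shrink_one h K.nonempty]
    refine ⟨L.starProjection, ⟨fun x => Submodule.starProjection_apply_mem _ _, fun x y hy => ?_⟩,
      L.starProjection.contDiff.contDiffOn⟩
    exact (L.starProjection_inner_eq_zero x _
      (L.sub_mem hy (Submodule.starProjection_apply_mem _ _))).le
  · obtain ⟨P, hP⟩ := exists_isNearestPoint hcl (convex_shrink K.convex t)
      ⟨_, K.nonempty.some, K.nonempty.some_mem, 0, zero_mem_recessionCone _, rfl⟩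
    refine ⟨P, hP, contDiffOn_nearestPoint hP hcl ?_⟩
    have hc : (1 - (t : ℝ))⁻¹ ≠ 0 := inv_ne_zero (by linarith)
    have hpre : shrink K.carrier t = (fun x => (1 - (t : ℝ))⁻¹ • x) ⁻¹' K.carrier := by
      ext x; exact mem_shrink_iff_of_lt h ht1 x
    have hfr : frontier (shrink K.carrier t) =
        (fun x => (1 - (t : ℝ))⁻¹ • x) ⁻¹' frontier K.carrier := by
      rw [hpre]
      exact ((Homeomorph.smulOfNeZero _ hc).preimage_frontier K.carrier).symm
    rw [hfr]
    exact isRegularHypersurface_preimage_smul hreg hk hc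

/-! ### The two deformation retractions -/

theorem exists_isCylinderOver_of_mem_bodies (hmn : m < n) {K : ClosedConvexSet n}
    (hK : K ∈ bodies n m) :
    ∃ L : Submodule ℝ (E n), IsCylinderOver K.carrier L ∧ Module.finrank ℝ L = m := by
  obtain ⟨L, hL, hLm⟩ := exists_recessionCone_eq_of_mem_bodies hmn hK
  exact ⟨L, isCylinderOver_of_recessionCone_eq K.isClosed K.convex hL, hLm⟩

theorem flow_mem_bodies (hm : 1 ≤ m) (hmn : m < n) {K : ClosedConvexSet n} (hK : K ∈ bodies n m)
    (t : I) : flow K t ∈ bodies n m := by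
  obtain ⟨L, h, hL⟩ := exists_isCylinderOver_of_mem_bodies hmn hK
  exact mem_bodies_of_isCylinderOver hm hmn (interior_flow_nonempty h hK.1 t) (h.flow t) hL

/-- The deformation, as a homotopy of the space of bodies. -/
def bodyFlow (hm : 1 ≤ m) (hmn : m < n) (p : bodies n m × I) : bodies n m :=
  ⟨flow p.1.1 p.2, flow_mem_bodies hm hmn p.1.2 p.2⟩

theorem isStrongDeformationRetraction_bodyFlow (hm : 1 ≤ m) (hmn : m < n) :
    IsStrongDeformationRetraction {K : bodies n m | K.1 ∈ cylinders n m} (bodyFlow hm hmn) where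
  continuous := (continuous_flow fun K hK => by
    obtain ⟨L, h, -⟩ := exists_isCylinderOver_of_mem_bodies hmn hK
    exact ⟨L, h⟩).subtype_mk _
  map_zero K := by
    obtain ⟨L, h, -⟩ := exists_isCylinderOver_of_mem_bodies hmn K.2
    exact Subtype.ext (flow_zero h)
  map_one_mem K := by
    obtain ⟨L, h, hL⟩ := exists_isCylinderOver_of_mem_bodies hmn K.2
    exact (mem_cylinders_iff hmn _).2 ⟨L, hL, mem_flow_one_iff h⟩
  map_of_mem K hK t := by
    obtain ⟨L, -, h⟩ := (mem_cylinders_iff hmn K.1).1 hK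
    exact Subtype.ext (flow_eq_self h t)

theorem isRegularityPreserving_bodyFlow (hm : 1 ≤ m) (hmn : m < n) :
    IsRegularityPreserving (fun K : bodies n m => frontier K.1.carrier) (bodyFlow hm hmn) := by
  intro K k hk hreg t
  obtain ⟨L, h, -⟩ := exists_isCylinderOver_of_mem_bodies hmn K.2
  exact isRegularHypersurface_frontier_flow h hk hreg t

/-- A convex body which is a cylinder over a proper subspace with bounded cross-section is the
convex hull of its boundary. -/
theorem convexHull_frontier_eq {K : Set (E n)} {L : Submodule ℝ (E n)} (hK : IsClosed K)
    (hc : Convex ℝ K) (h : IsCylinderOver K L) (hL : Module.finrank ℝ L < n) :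
    convexHull ℝ (frontier K) = K := by
  refine (convexHull_min hK.frontier_subset hc).antisymm fun x hx => ?_
  -- A line through `x` in a direction orthogonal to `L` leaves `K` on both sides.
  obtain ⟨v, hv, hv0⟩ : ∃ v ∈ Lᗮ, v ≠ 0 := by
    refine (Submodule.ne_bot_iff _).1 fun hbot => ?_
    have := finrank_orthogonal L
    rw [hbot, finrank_bot] at this
    omega
  have key : ∀ u ∈ Lᗮ, u ≠ 0 → ∃ s : ℝ, 0 ≤ s ∧ x + s • u ∈ frontier K := by
    intro u hu hu0
    have hnot : ∃ s : ℝ, 0 ≤ s ∧ x + s • u ∉ K := by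
      by_contra! hall
      have h1 : u ∈ recessionCone K := by
        rw [recessionCone_eq_asymptoticCone hK hc ⟨x, hx⟩]
        exact mem_asymptoticCone_of_ray fun k => hall k (Nat.cast_nonneg k)
      rw [h.recessionCone_eq ⟨x, hx⟩] at h1
      exact hu0 ((Submodule.disjoint_def.1 L.orthogonal_disjoint) u h1 hu)
    obtain ⟨r, hr, hrK⟩ := hnot
    have hconn : IsPreconnected ((fun s : ℝ => x + s • u) '' Icc 0 r) :=
      isPreconnected_Icc.image _ (by fun_prop)
    by_contra! hfr
    have hint : ∀ s : ℝ, 0 ≤ s → x + s • u ∈ K → x + s • u ∈ interior K := fun s hs hsK => by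
      by_contra hsi
      exact hfr s hs ⟨subset_closure hsK, hsi⟩
    have hcov : (fun s : ℝ => x + s • u) '' Icc 0 r ⊆ interior K ∪ Kᶜ := by
      rintro _ ⟨s, hs, rfl⟩
      exact (em (x + s • u ∈ K)).imp_left (hint s hs.1)
    have hsub := hconn.subset_left_of_subset_union isOpen_interior hK.isOpen_compl
      (disjoint_compl_right.mono_left interior_subset) hcov
      ⟨_, mem_image_of_mem _ (left_mem_Icc.2 hr), hint 0 le_rfl (by simpa)⟩
    exact hrK (interior_subset (hsub (mem_image_of_mem _ (right_mem_Icc.2 hr))))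
  obtain ⟨a, ha, haK⟩ := key v hv hv0
  obtain ⟨b, hb, hbK⟩ := key (-v) (Lᗮ.neg_mem hv) (neg_ne_zero.2 hv0)
  refine (convex_convexHull ℝ (frontier K)).segment_subset (subset_convexHull ℝ _ hbK)
    (subset_convexHull ℝ _ haK) ?_
  rcases (add_nonneg ha hb).eq_or_lt with h0 | h0
  · have ha0 : a = 0 := by linarith
    have hb0 : b = 0 := by linarith
    simp [ha0, hb0]
  · refine ⟨a / (a + b), b / (a + b), by positivity, by positivity, ?_, ?_⟩
    · rw [← add_div, div_self h0.ne']
    · rw [smul_add, smul_add, smul_smul, smul_smul, smul_neg, add_add_add_comm, ← add_smul,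
        ← add_div, div_self h0.ne', one_smul,
        show a / (a + b) * b = b / (a + b) * a by ring]
      simp

/-- A body is determined by its boundary. -/
theorem boundaryMap_bijective (hmn : m < n) : Function.Bijective (boundaryMap (bodies n m)) := by
  refine ⟨fun K K' hKK' => ?_, fun ⟨M, K, hK, hM⟩ => ⟨⟨K, hK⟩, by simp [boundaryMap, hM]⟩⟩
  have hfr : frontier K.1.carrier = frontier K'.1.carrier := congrArg Boundaries.carrier hKK'
  have hull : ∀ K : bodies n m, convexHull ℝ (frontier K.1.carrier) = K.1.carrier := fun K => by
    obtain ⟨L, h, hL⟩ := exists_isCylinderOver_of_mem_bodies hmn K.2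
    exact convexHull_frontier_eq K.1.isClosed K.1.convex h (hL.trans_lt hmn)
  refine Subtype.ext (ClosedConvexSet.ext ?_)
  rw [← hull K, ← hull K', hfr]

/-- Since a body is determined by its boundary, the boundary map is a homeomorphism. -/
def boundaryHomeomorph (hmn : m < n) : bodies n m ≃ₜ Boundaries (bodies n m) where
  toEquiv := Equiv.ofBijective _ (boundaryMap_bijective hmn)
  continuous_toFun := continuous_coinduced_rng
  continuous_invFun := continuous_coinduced_dom.2 (by
    convert! continuous_id using 1
    funext K
    exact Equiv.ofBijective_symm_apply_apply _ (boundaryMap_bijective hmn) K)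

end Regularity

end AsymptoticConvex

end

theorem mainTheorem8 (n m : ℕ) (hm : 1 ≤ m) (hmn : m < n) :
    AsymptoticConvex.cylinders n m ⊆ AsymptoticConvex.bodies n m ∧
    (∃ H : AsymptoticConvex.bodies n m × unitInterval → AsymptoticConvex.bodies n m,
      AsymptoticConvex.IsStrongDeformationRetraction
        {K : AsymptoticConvex.bodies n m | K.1 ∈ AsymptoticConvex.cylinders n m} H ∧
      AsymptoticConvex.IsRegularityPreserving
        (fun K : AsymptoticConvex.bodies n m => frontier K.1.carrier) H) ∧
    (∃ H : AsymptoticConvex.Boundaries (AsymptoticConvex.bodies n m) × unitInterval →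
        AsymptoticConvex.Boundaries (AsymptoticConvex.bodies n m),
      AsymptoticConvex.IsStrongDeformationRetraction
        (AsymptoticConvex.cylinderBoundaries n m) H ∧
      AsymptoticConvex.IsRegularityPreserving
        (fun M : AsymptoticConvex.Boundaries (AsymptoticConvex.bodies n m) => M.carrier) H) := by
  have hH := AsymptoticConvex.isStrongDeformationRetraction_bodyFlow hm hmn
  have hreg := AsymptoticConvex.isRegularityPreserving_bodyFlow hm hmn
  refine ⟨AsymptoticConvex.cylinders_subset_bodies hm hmn,
    ⟨AsymptoticConvex.bodyFlow hm hmn, hH, hreg⟩, ?_⟩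
  let e := AsymptoticConvex.boundaryHomeomorph (m := m) hmn
  have hcar : ∀ K, (e K).carrier = frontier K.1.carrier := fun K => rfl
  have hcar' : ∀ M, frontier (e.symm M).1.carrier = M.carrier := fun M => by
    rw [← hcar, e.apply_symm_apply]
  -- The homotopy of the boundaries is the conjugate of the homotopy of the bodies by `e`.
  refine ⟨fun p => e (AsymptoticConvex.bodyFlow hm hmn (e.symm p.1, p.2)),
    ⟨?_, fun M => ?_, fun M => ?_, fun M hM t => ?_⟩, fun M k hk hM t => ?_⟩
  · exact e.continuous.comp (hH.continuous.comp
      ((e.symm.continuous.comp continuous_fst).prodMk continuous_snd))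
  · simp only [hH.map_zero, e.apply_symm_apply]
  · exact ⟨_, hH.map_one_mem (e.symm M), rfl⟩
  · obtain ⟨K, hK, hKM⟩ := hM
    have hKe : e.symm M = ⟨K, AsymptoticConvex.cylinders_subset_bodies hm hmn hK⟩ := by
      rw [e.symm_apply_eq]
      cases M
      cases hKM
      rfl
    have := hH.map_of_mem (e.symm M) (by rw [hKe]; exact hK) t
    simp only [this, e.apply_symm_apply]
  · exact hreg (e.symm M) k hk (by
      change AsymptoticConvex.IsRegularHypersurface k (frontier (e.symm M).1.carrier)
      rwa [hcar']) t
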